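/- Let $d\ge 0$ be an integer and $A_d=\mathbb{C}[z_1,\dots,z_d]$. A contractive (Hilbert) $A_d$-module is a complex Hilbert space $H$ with a compatible $A_d$-module structure such that $\|\sum_{i=1}^d z_i\xi_i\|^2\le\sum_{i=1}^d\|\xi_i\|^2$ for all $\xi_1,\dots,\xi_d\in H$. Let $H_d^2$ be the Hilbert space of functions on the unit ball $B_d\subset\mathbb{C}^d$ with reproducing kernel $k(z,w)=1/(1-\langle z,w\rangle)$, on which polynomials act by pointwise multiplication. For a Hilbert space $C$, the free module $H_d^2\otimes C$ is the Hilbert space tensor product, with action $p(f\otimes\eta)=(pf)\otimes\eta$. For $\xi\in H_d^2\otimes C$ and $\lambda\in B_d$, the value $\xi(\lambda)\in C$ is defined by $\langle\xi(\lambda),\eta\rangle=\langle\xi,k(\cdot,\lambda)\otimes\eta\rangle$ for all $\eta\in C$. For a bounded $A_d$-module homomorphism $\Phi:H_d^2\otimes D\to H_d^2\otimes C$, its localization $\Phi(\lambda):D\to C$ is defined by $\Phi(\lambda)\eta=(\Phi(1\otimes\eta))(\lambda)$. A contractive $A_d$-module $H$ is pure if there are a Hilbert space $C$ and a bounded module homomorphism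 $U:H_d^2\otimes C\to H$ with $UU^*=1$. **Theorem.** Let $H$ be a pure contractive $A_d$-module, and let $$\cdots\xrightarrow{\Phi_2}H_d^2\otimes C_1\xrightarrow{\Phi_1}H_d^2\otimes C_0\xrightarrow{\Phi_0}H\to 0$$ be a free resolution of $H$, i.e. an exact sequence of bounded $A_d$-module homomorphisms, where the $C_n$ are Hilbert spaces. Let $\partial_k:H\otimes\bigwedge^k\mathbb{C}^d\to H\otimes\bigwedge^{k-1}\mathbb{C}^d$, $$\partial_k(\xi\otimes e_{i_1}\wedge\cdots\wedge e_{i_k})=\sum_{j=1}^k(-1)^{j+1}z_{i_j}\xi\otimes e_{i_1}\wedge\cdots\wedge\widehat{e_{i_j}}\wedge\cdots\wedge e_{i_k},$$ be the boundary maps of the Koszul complex of $H$. Then for every $k\ge 1$ there is an isomorphism of complex vector spaces $$\frac{\ker\partial_k}{\operatorname{im}\partial_{k+1}}\;\cong\;\frac{\ker\Phi_k(0)}{\operatorname{im}\Phi_{k+1}(0)}.$$ -/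

import Mathlib

noncomputable section

open scoped TensorProduct InnerProductSpace

/-- The polynomial ring `ℂ[z₁, …, z_d]`. -/
abbrev PolyRing (d : ℕ) : Type := MvPolynomial (Fin d) ℂ

/-- The open unit ball of `ℂ^d` (with the Euclidean norm). -/
abbrev UnitBall (d : ℕ) : Type := Metric.ball (0 : EuclideanSpace ℂ (Fin d)) 1

/-- The centre of the unit ball. -/
def UnitBall.zero (d : ℕ) : UnitBall d := ⟨0, Metric.mem_ball_self one_pos⟩

/-- The kernel `k(z, w) = 1 / (1 - ⟨z, w⟩)`, where `⟨z, w⟩ = ∑ i, z i * conj (w i)`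
(Mathlib's `inner ℂ w z`). -/
def daKer (d : ℕ) (z w : UnitBall d) : ℂ :=
  1 / (1 - inner ℂ (w : EuclideanSpace ℂ (Fin d)) (z : EuclideanSpace ℂ (Fin d)))

/-- The kernel `k` as an operator-valued matrix: `k(z, w)` acts on `ℂ` by multiplication. -/
def daKernel (d : ℕ) : Matrix (UnitBall d) (UnitBall d) (ℂ →L[ℂ] ℂ) :=
  Matrix.of fun z w => daKer d z w • ContinuousLinearMap.id ℂ ℂ

theorem norm_inner_lt_one {d : ℕ} (z w : UnitBall d) :
    ‖inner ℂ (w : EuclideanSpace ℂ (Fin d)) (z : EuclideanSpace ℂ (Fin d))‖ < 1 := by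
  have hz : ‖(z : EuclideanSpace ℂ (Fin d))‖ < 1 := mem_ball_zero_iff.mp z.2
  have hw : ‖(w : EuclideanSpace ℂ (Fin d))‖ < 1 := mem_ball_zero_iff.mp w.2
  refine (norm_inner_le_norm _ _).trans_lt ?_
  nlinarith [norm_nonneg (z : EuclideanSpace ℂ (Fin d)),
    norm_nonneg (w : EuclideanSpace ℂ (Fin d))]

theorem daKer_conj {d : ℕ} (z w : UnitBall d) : star (daKer d z w) = daKer d w z := by
  simp [daKer]

theorem daKer_mul {d : ℕ} (z w : UnitBall d) :
    daKer d z w * (1 - ∑ i, z.1 i * star (w.1 i)) = 1 := by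
  have h := norm_inner_lt_one z w
  have h1 : (1 : ℂ) - inner ℂ w.1 z.1 ≠ 0 := by
    intro h0
    rw [← sub_eq_zero.mp h0] at h
    simp at h
  have h2 : inner ℂ w.1 z.1 = ∑ i, z.1 i * star (w.1 i) := by
    simp [PiLp.inner_apply]
  rw [← h2, daKer, one_div, inv_mul_cancel₀ h1]

/-- Expansion of the kernel in words over `{1, …, d}`. -/
theorem hasSum_daKer {d : ℕ} (z w : UnitBall d) :
    HasSum (fun n : ℕ => ∑ I : Fin n → Fin d, (∏ j, z.1 (I j)) * star (∏ j, w.1 (I j)))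
      (daKer d z w) := by
  have h := hasSum_geometric_of_norm_lt_one (norm_inner_lt_one z w)
  rw [daKer, one_div]
  convert! h using 2 with n
  rw [PiLp.inner_apply, Fintype.sum_pow]
  simp [Finset.prod_mul_distrib]

theorem daKernel_posSemidef (d : ℕ) : (daKernel d).PosSemidef := by
  have h := (RKHS.posSemidef_tfae (K := daKernel d)).out 0 2
  refine h.mpr ⟨?_, fun c => ?_⟩
  · ext z w : 2
    have h1 : star (ContinuousLinearMap.id ℂ ℂ) = ContinuousLinearMap.id ℂ ℂ :=
      star_one (ℂ →L[ℂ] ℂ)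
    rw [Matrix.conjTranspose_apply]
    simp only [daKernel, Matrix.of_apply, star_smul, daKer_conj, h1]
  · have key : HasSum (fun n : ℕ => ∑ I : Fin n → Fin d,
        star (c.sum fun z a => a * ∏ j, star (z.1 (I j))) *
          (c.sum fun z a => a * ∏ j, star (z.1 (I j))))
        (c.sum fun x w => c.sum fun x' w' => inner ℂ (daKernel d x' x w) w') := by
      have h1 : ∀ x ∈ c.support, ∀ x' ∈ c.support, HasSum (fun n : ℕ => ∑ I : Fin n → Fin d,
          star (c x * ∏ j, star (x.1 (I j))) * (c x' * ∏ j, star (x'.1 (I j))))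
          (inner ℂ (daKernel d x' x (c x)) (c x')) := by
        intro x _ x' _
        have h2 := (hasSum_daKer x x').mul_left (star (c x) * c x')
        convert! h2 using 1
        · ext n
          rw [Finset.mul_sum]
          refine Finset.sum_congr rfl fun I _ => ?_
          simp only [star_mul, star_prod, star_star]
          ring
        · simp [daKernel, ← daKer_conj x x']
          ring
      have h3 := hasSum_sum fun x hx => hasSum_sum (h1 x hx)
      convert! h3 using 1
      ext n
      simp only [Finsupp.sum]
      rw [Finset.sum_congr rfl fun x _ => Finset.sum_comm, Finset.sum_comm]
      refine Finset.sum_congr rfl fun I _ => ?_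
      rw [star_sum, Finset.sum_mul_sum]
    have h4 := Complex.hasSum_re key
    refine h4.nonneg fun n => ?_
    simp only [Complex.re_sum]
    refine Finset.sum_nonneg fun I _ => ?_
    rw [Complex.star_def, Complex.conj_mul']
    norm_cast
    positivity

instance daKernel_fact (d : ℕ) : Fact (daKernel d).PosSemidef := ⟨daKernel_posSemidef d⟩

/-- The Hilbert function space `H_d²`: the space of functions on the unit ball of `ℂ^d`
with reproducing kernel `1 / (1 - ⟨z, w⟩)`. -/
def DruryArveson (d : ℕ) : Type := RKHS.OfKernel (daKernel d)

namespace DruryArveson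

variable {d : ℕ}

instance : NormedAddCommGroup (DruryArveson d) :=
  inferInstanceAs (NormedAddCommGroup (RKHS.OfKernel (daKernel d)))

instance : InnerProductSpace ℂ (DruryArveson d) :=
  inferInstanceAs (InnerProductSpace ℂ (RKHS.OfKernel (daKernel d)))

instance : CompleteSpace (DruryArveson d) :=
  inferInstanceAs (CompleteSpace (RKHS.OfKernel (daKernel d)))

instance : RKHS ℂ (DruryArveson d) (UnitBall d) ℂ :=
  inferInstanceAs (RKHS ℂ (RKHS.OfKernel (daKernel d)) (UnitBall d) ℂ)

theorem kernel_eq : RKHS.kernel (DruryArveson d) = daKernel d :=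
  RKHS.OfKernel.kernel_ofKernel

/-- The function `k_w = k(·, w)`, as an element of `H_d²`. -/
def k (w : UnitBall d) : DruryArveson d := RKHS.kerFun (DruryArveson d) w 1

theorem k_apply (w z : UnitBall d) : k w z = daKer d z w := by
  rw [k, RKHS.kerFun_apply, kernel_eq]
  simp [daKernel]

/-- The reproducing property. -/
theorem inner_k (w : UnitBall d) (f : DruryArveson d) : inner ℂ (k w) f = f w := by
  simp [k]

theorem denseRange_k :
    DenseRange (Finsupp.linearCombination ℂ (k : UnitBall d → DruryArveson d)) := by
  have h := RKHS.kerFun_dense (DruryArveson d)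
  have h2 : Submodule.span ℂ {x | ∃ (w : UnitBall d) (v : ℂ), RKHS.kerFun (DruryArveson d) w v = x}
      ≤ LinearMap.range (Finsupp.linearCombination ℂ (k : UnitBall d → DruryArveson d)) := by
    rw [Submodule.span_le]
    rintro _ ⟨w, v, rfl⟩
    refine ⟨Finsupp.single w v, ?_⟩
    rw [Finsupp.linearCombination_single, k, ← map_smul, smul_eq_mul, mul_one]
  have h3 := Submodule.topologicalClosure_mono h2
  rw [h, top_le_iff] at h3
  rw [DenseRange, dense_iff_closure_eq]
  exact congrArg (fun S : Submodule ℂ (DruryArveson d) => (S : Set (DruryArveson d))) h3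

/-- The operator `k_w ↦ conj (w i) k_w`, on formal combinations of kernel functions. -/
def preShift (i : Fin d) : (UnitBall d →₀ ℂ) →ₗ[ℂ] DruryArveson d :=
  Finsupp.linearCombination ℂ fun w => star (w.1 i) • k w

theorem preShift_norm_le (i : Fin d) (c : UnitBall d →₀ ℂ) :
    ‖preShift i c‖ ≤ 1 * ‖Finsupp.linearCombination ℂ (k : UnitBall d → DruryArveson d) c‖ := by
  have hn : ∀ g : UnitBall d → ℂ,
      ((‖∑ w ∈ c.support, (c w * g w) • k w‖ ^ 2 : ℝ) : ℂ) =
        ∑ w ∈ c.support, ∑ z ∈ c.support,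
          star (c w) * c z * (daKer d w z * (g z * star (g w))) := by
    intro g
    have := inner_self_eq_norm_sq_to_K (𝕜 := ℂ) (∑ w ∈ c.support, (c w * g w) • k w)
    push_cast
    rw [← Complex.coe_algebraMap, ← this, sum_inner]
    refine Finset.sum_congr rfl fun w _ => ?_
    rw [inner_sum]
    refine Finset.sum_congr rfl fun z _ => ?_
    rw [inner_smul_left, inner_smul_right, inner_k, k_apply]
    simp
    ring
  have h1 : (‖∑ w ∈ c.support, (c w * 1) • k w‖ ^ 2 : ℝ) =
      ‖∑ w ∈ c.support, c w‖ ^ 2 +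
        ∑ j, ‖∑ w ∈ c.support, (c w * star (w.1 j)) • k w‖ ^ 2 := by
    apply Complex.ofReal_injective
    rw [hn fun _ => 1, Complex.ofReal_add, Complex.ofReal_sum,
      Finset.sum_congr rfl fun j _ => hn fun w => star (w.1 j), Complex.ofReal_pow,
      ← Complex.conj_mul', map_sum, Finset.sum_mul_sum, Finset.sum_comm (s := (Finset.univ : Finset (Fin d))),
      ← Finset.sum_add_distrib]
    refine Finset.sum_congr rfl fun w _ => ?_
    rw [Finset.sum_comm (s := (Finset.univ : Finset (Fin d))), ← Finset.sum_add_distrib]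
    refine Finset.sum_congr rfl fun z _ => ?_
    have h := daKer_mul w z
    rw [← Finset.mul_sum, ← Finset.mul_sum]
    simp only [star_one, mul_one, star_star, starRingEnd_apply]
    rw [Finset.sum_congr rfl fun j _ => mul_comm (star (z.1 j)) (w.1 j)]
    linear_combination (star (c w) * c z) * h
  have h2 : preShift i c = ∑ w ∈ c.support, (c w * star (w.1 i)) • k w := by
    simp [preShift, Finsupp.linearCombination_apply, Finsupp.sum, mul_smul]
  have h3 : Finsupp.linearCombination ℂ (k : UnitBall d → DruryArveson d) c =
      ∑ w ∈ c.support, (c w * 1) • k w := by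
    simp [Finsupp.linearCombination_apply, Finsupp.sum]
  rw [one_mul, h2, h3]
  refine (sq_le_sq₀ (norm_nonneg _) (norm_nonneg _)).mp ?_
  rw [h1]
  have h4 := Finset.single_le_sum
    (f := fun j => ‖∑ w ∈ c.support, (c w * star (w.1 j)) • k w‖ ^ 2)
    (fun j _ => sq_nonneg _) (Finset.mem_univ i)
  have h5 := sq_nonneg ‖∑ w ∈ c.support, c w‖
  simp only at h4
  linarith

theorem exists_mul_coord (i : Fin d) :
    ∃ M : DruryArveson d →L[ℂ] DruryArveson d, ∀ f z, (M f) z = z.1 i * f z := by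
  refine ⟨((preShift i).extendOfNorm (Finsupp.linearCombination ℂ k)).adjoint, fun f z => ?_⟩
  have h := LinearMap.extendOfNorm_eq (f := preShift i) (denseRange_k (d := d))
    ⟨1, preShift_norm_le i⟩ (Finsupp.single z 1)
  rw [Finsupp.linearCombination_single, one_smul, preShift, Finsupp.linearCombination_single,
    one_smul] at h
  rw [← inner_k, ContinuousLinearMap.adjoint_inner_right, preShift, h, inner_smul_left, inner_k]
  simp

/-- Polynomials are multipliers of `H_d²`: multiplication by `p` is a bounded operator. -/
theorem exists_mul (p : PolyRing d) :
    ∃ M : DruryArveson d →L[ℂ] DruryArveson d,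
      ∀ f z, (M f) z = MvPolynomial.eval (fun i => z.1 i) p * f z := by
  induction p using MvPolynomial.induction_on with
  | C a => exact ⟨a • ContinuousLinearMap.id ℂ _, fun f z => by simp⟩
  | add p q hp hq =>
    obtain ⟨M, hM⟩ := hp
    obtain ⟨N, hN⟩ := hq
    exact ⟨M + N, fun f z => by simp [hM, hN, add_mul]⟩
  | mul_X p i hp =>
    obtain ⟨M, hM⟩ := hp
    obtain ⟨N, hN⟩ := exists_mul_coord i
    exact ⟨M ∘L N, fun f z => by simp [hM, hN, mul_assoc]⟩

/-- The bounded operator on `H_d²` of multiplication by the polynomial `p`. -/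
def mulOp (p : PolyRing d) : DruryArveson d →L[ℂ] DruryArveson d := (exists_mul p).choose

theorem mulOp_apply (p : PolyRing d) (f : DruryArveson d) (z : UnitBall d) :
    mulOp p f z = MvPolynomial.eval (fun i => z.1 i) p * f z :=
  (exists_mul p).choose_spec f z

/-- `H_d²` is a module over the polynomial ring, by pointwise multiplication. -/
instance : Module (PolyRing d) (DruryArveson d) where
  smul p f := mulOp p f
  one_smul f := RKHS.ext fun z => by
    change mulOp 1 f z = f z
    simp [mulOp_apply]
  mul_smul p q f := RKHS.ext fun z => by
    change mulOp (p * q) f z = mulOp p (mulOp q f) z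
    simp [mulOp_apply, mul_assoc]
  smul_zero p := map_zero (mulOp p)
  smul_add p f g := map_add (mulOp p) f g
  add_smul p q f := RKHS.ext fun z => by
    change mulOp (p + q) f z = (mulOp p f + mulOp q f) z
    simp [mulOp_apply, add_mul]
  zero_smul f := RKHS.ext fun z => by
    change mulOp 0 f z = (0 : DruryArveson d) z
    simp [mulOp_apply]

theorem smul_eq_mulOp (p : PolyRing d) (f : DruryArveson d) : p • f = mulOp p f := rfl

theorem smul_apply (p : PolyRing d) (f : DruryArveson d) (z : UnitBall d) :
    (p • f) z = MvPolynomial.eval (fun i => z.1 i) p * f z := mulOp_apply p f z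

instance : IsScalarTower ℂ (PolyRing d) (DruryArveson d) where
  smul_assoc c p f := RKHS.ext fun z => by
    simp [smul_apply, mul_assoc]

variable {C : Type*} [NormedAddCommGroup C] [InnerProductSpace ℂ C]

theorem smul_tensor (p : PolyRing d) (x : DruryArveson d ⊗[ℂ] C) :
    p • x = (mulOp p).rTensor C x := by
  induction x using TensorProduct.induction_on with
  | zero => simp
  | tmul f η => rw [TensorProduct.smul_tmul', smul_eq_mulOp, ContinuousLinearMap.rTensor_tmul]
  | add x y hx hy => rw [smul_add, hx, hy, map_add]

instance : UniformContinuousConstSMul (PolyRing d) (DruryArveson d ⊗[ℂ] C) where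
  uniformContinuous_const_smul p := by
    simp only [smul_tensor]
    exact ((mulOp p).rTensor C).uniformContinuous

end DruryArveson

/-- The free module `H_d² ⊗ C`: the Hilbert space tensor product, i.e. the completion of the
algebraic tensor product of inner product spaces. Polynomials act by `p • (f ⊗ η) = (p f) ⊗ η`,
extended by continuity. -/
abbrev FreeModule (d : ℕ) (C : Type*) [NormedAddCommGroup C] [InnerProductSpace ℂ C] : Type _ :=
  UniformSpace.Completion (DruryArveson d ⊗[ℂ] C)

namespace FreeModule

variable {d : ℕ} {C D : Type*} [NormedAddCommGroup C] [InnerProductSpace ℂ C]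
  [NormedAddCommGroup D] [InnerProductSpace ℂ D]

/-- The map `η ↦ f ⊗ η`. -/
def tmulL (f : DruryArveson d) : C →L[ℂ] FreeModule d C :=
  UniformSpace.Completion.toComplL ∘L TensorProduct.mkL ℂ (DruryArveson d) C f

/-- The value at `z` of an element of `H_d² ⊗ C`, viewed as a `C`-valued function:
`⟨η, ξ(z)⟩ = ⟨k_z ⊗ η, ξ⟩`. -/
def eval [CompleteSpace C] (z : UnitBall d) : FreeModule d C →L[ℂ] C :=
  (tmulL (DruryArveson.k z)).adjoint

/-- The constant function `1`, which is `k_0`. -/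
def one (d : ℕ) : DruryArveson d := DruryArveson.k (UnitBall.zero d)

theorem one_apply (z : UnitBall d) : one d z = 1 := by
  simp [one, DruryArveson.k_apply, daKer, UnitBall.zero]

theorem inner_eval [CompleteSpace C] (z : UnitBall d) (η : C) (ξ : FreeModule d C) :
    inner ℂ η (eval z ξ) = inner ℂ (tmulL (DruryArveson.k z) η) ξ :=
  ContinuousLinearMap.adjoint_inner_right _ _ _

theorem eval_tmulL [CompleteSpace C] (z : UnitBall d) (f : DruryArveson d) (η : C) :
    eval z (tmulL f η) = f z • η := by
  refine ext_inner_left ℂ fun v => ?_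
  rw [inner_eval, inner_smul_right, ← DruryArveson.inner_k]
  simp [tmulL, TensorProduct.mkL_apply_apply]

theorem smul_tmulL (p : PolyRing d) (f : DruryArveson d) (η : C) :
    p • (tmulL f η : FreeModule d C) = tmulL (p • f) η := by
  change p • ((f ⊗ₜ[ℂ] η : DruryArveson d ⊗[ℂ] C) : FreeModule d C) = _
  rw [← UniformSpace.Completion.coe_smul, TensorProduct.smul_tmul']
  rfl

/-- The localization of a bounded module homomorphism `Φ : H_d² ⊗ D → H_d² ⊗ C` at the point
`z` of the ball: `Φ(z) η = (Φ (1 ⊗ η))(z)`. -/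
def localize [CompleteSpace C] (Φ : FreeModule d D →L[PolyRing d] FreeModule d C)
    (z : UnitBall d) : D →L[ℂ] C :=
  eval z ∘L Φ.restrictScalars ℂ ∘L tmulL (one d)

end FreeModule

/-- A contractive Hilbert module over `ℂ[z₁, …, z_d]`: a Hilbert space that is a module
(with scalar polynomials acting as the scalars) such that
`‖∑ z_k ξ_k‖² ≤ ∑ ‖ξ_k‖²`. -/
class ContractiveModule (d : ℕ) (H : Type*) [NormedAddCommGroup H] [InnerProductSpace ℂ H]
    [CompleteSpace H] [Module (PolyRing d) H] : Prop extends
    IsScalarTower ℂ (PolyRing d) H where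
  norm_sum_sq_le (ξ : Fin d → H) :
    ‖∑ i, (MvPolynomial.X i : PolyRing d) • ξ i‖ ^ 2 ≤ ∑ i, ‖ξ i‖ ^ 2

/-- A contractive module `H` is pure if it is unitarily isomorphic to a quotient of a free
module, i.e. there is a coisometric module homomorphism `U` from a free module onto `H`. -/
def IsPure.{u} (d : ℕ) (H : Type u) [NormedAddCommGroup H] [InnerProductSpace ℂ H]
    [CompleteSpace H] [Module (PolyRing d) H] [ContractiveModule d H] : Prop :=
  ∃ (C : Type u) (_ : NormedAddCommGroup C) (_ : InnerProductSpace ℂ C) (_ : CompleteSpace C)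
    (U : FreeModule d C →L[PolyRing d] H),
    U.restrictScalars ℂ ∘L (U.restrictScalars ℂ).adjoint = ContinuousLinearMap.id ℂ H

/-- A free resolution of `H`: an exact sequence
`⋯ → H_d² ⊗ C₂ → H_d² ⊗ C₁ → H_d² ⊗ C₀ → H → 0` of bounded module homomorphisms.
The map `Φ n` goes from `H_d² ⊗ C (n+1)` to `H_d² ⊗ C n`, and `aug` goes from
`H_d² ⊗ C 0` to `H`. -/
structure FreeResolution (d : ℕ) (H : Type*) [NormedAddCommGroup H] [InnerProductSpace ℂ H]
    [CompleteSpace H] [Module (PolyRing d) H] (C : ℕ → Type*)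
    [∀ n, NormedAddCommGroup (C n)] [∀ n, InnerProductSpace ℂ (C n)]
    [∀ n, CompleteSpace (C n)] where
  Φ (n : ℕ) : FreeModule d (C (n + 1)) →L[PolyRing d] FreeModule d (C n)
  aug : FreeModule d (C 0) →L[PolyRing d] H
  exact (n : ℕ) : Function.Exact (Φ (n + 1)) (Φ n)
  exact_aug : Function.Exact (Φ 0) aug
  surjective_aug : Function.Surjective aug

section Koszul

variable {d : ℕ}

/-- The contraction `⋀^(k+1) ℂ^d → ⋀^k ℂ^d` by the `i`-th coordinate functional:
`v₀ ∧ ⋯ ∧ v_k ↦ ∑ j, (-1)^j (v_j)_i v₀ ∧ ⋯ ∧ v̂_j ∧ ⋯ ∧ v_k`. It is the adjoint of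
`e_i ∧ ·`. -/
def contract (i : Fin d) (k : ℕ) : ⋀[ℂ]^(k + 1) (Fin d → ℂ) →ₗ[ℂ] ⋀[ℂ]^k (Fin d → ℂ) :=
  exteriorPower.alternatingMapLinearEquiv
    (AlternatingMap.alternatizeUncurryFin
      ((LinearMap.proj i : (Fin d → ℂ) →ₗ[ℂ] ℂ).smulRight (exteriorPower.ιMulti ℂ k)))

/-- The Koszul boundary map `∂_{k+1} : H ⊗ ⋀^(k+1) ℂ^d → H ⊗ ⋀^k ℂ^d`, that is
`∑ i, z_i ⊗ (contraction by e_i)`. -/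
def koszulD (H : Type*) [AddCommGroup H] [Module ℂ H] [Module (PolyRing d) H]
    [IsScalarTower ℂ (PolyRing d) H] (k : ℕ) :
    H ⊗[ℂ] ⋀[ℂ]^(k + 1) (Fin d → ℂ) →ₗ[ℂ] H ⊗[ℂ] ⋀[ℂ]^k (Fin d → ℂ) :=
  ∑ i : Fin d, TensorProduct.map (Algebra.lsmul ℂ ℂ H (MvPolynomial.X i : PolyRing d))
    (contract i k)

/-- The usual formula for the Koszul boundary map on `ξ ⊗ e_{I 0} ∧ ⋯ ∧ e_{I k}`. -/
theorem koszulD_tmul (H : Type*) [AddCommGroup H] [Module ℂ H] [Module (PolyRing d) H]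
    [IsScalarTower ℂ (PolyRing d) H] (k : ℕ) (ξ : H) (I : Fin (k + 1) → Fin d) :
    koszulD H k (ξ ⊗ₜ exteriorPower.ιMulti ℂ (k + 1) fun j => Pi.single (I j) 1) =
      ∑ j : Fin (k + 1), (-1 : ℂ) ^ (j : ℕ) •
        (((MvPolynomial.X (I j) : PolyRing d) • ξ) ⊗ₜ[ℂ]
          exteriorPower.ιMulti ℂ k fun l => (Pi.single (I (j.succAbove l)) 1 : Fin d → ℂ)) := by
  simp only [koszulD, contract, LinearMap.sum_apply, TensorProduct.map_tmul,
    exteriorPower.alternatingMapLinearEquiv_apply_ιMulti,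
    AlternatingMap.alternatizeUncurryFin_apply, TensorProduct.tmul_sum]
  rw [Finset.sum_comm]
  refine Finset.sum_congr rfl fun j _ => ?_
  rw [Finset.sum_eq_single (I j)]
  · rcases Nat.even_or_odd (j : ℕ) with h | h
    · simp [h.neg_one_pow]
      rfl
    · simp [h.neg_one_pow, TensorProduct.tmul_neg]
      rfl
  · intro b _ hb
    simp [Pi.single_eq_of_ne hb]
  · simp

end Koszul

/-- The homology `ker g / im f` of `A → B → C`. -/
abbrev HomologyAt {A B C : Type*} [AddCommGroup A] [AddCommGroup B] [AddCommGroup C]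
    [Module ℂ A] [Module ℂ B] [Module ℂ C] (f : A →ₗ[ℂ] B) (g : B →ₗ[ℂ] C) : Type _ :=
  LinearMap.ker g ⧸ (LinearMap.range f).submoduleOf (LinearMap.ker g)

end

/-! Both sides compute Tor of `H` against the residue field at the origin. Resolving the residue
field by the Koszul complex gives the left side; resolving `H` by free modules gives the right side,
once it is known that `H_d² ⊗ C` behaves like a free module: its Koszul complex is exact in positive
degrees, and its zeroth homology is `C`, through evaluation at `0`.

Acyclicity rests on Cartan's formula. On `z^a` tensored with a `k`-form, the anticommutator of the
Koszul boundary with the exterior derivative `∑ ∂_i ⊗ (e_i ∧ ·)` is multiplication by `|a| + k`.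
Dividing by this number when `k ≥ 1` gives a contracting homotopy. It must be bounded in order to
extend to the completed tensor product with `C`. This follows from `‖z^a‖² = a!/|a|!`
(`norm_mono_sq`), by which the backward shift `M_i^*` sends `z^a` to `(a_i/|a|) z^(a - e_i)`: the
rescaled derivatives are diagonal contractions combined with backward shifts (`exists_homotopy`,
`koszulD_exact`).

The zeroth homology comes from the identity that `∑ M_i M_i^*` is the identity minus the projection
onto constants (`sum_mul_backShift`, `koszulAug_exact`). The same identity gives `(Φ ξ)(0) = Φ(0)
ξ(0)` (`eval_zero_apply`), so a module map `Φ` induces `Φ(0)` on zeroth homology.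

The rest is homological algebra (`nonempty_koszul_homology_equiv`): dimension shifting along the
kernels in the resolution lowers the degree to one, where a diagram chase ends the proof. -/

noncomputable section

open scoped TensorProduct InnerProductSpace

/-! ### Contraction and exterior multiplication. -/

section Exterior

-- The antiderivation rule, expanded along the first factor. It ties the alternating sum defining
-- `contract` to `contractLeft`, whose identities then transfer to exterior powers.
open CliffordAlgebra in
theorem contractLeft_ιMulti {M : Type*} [AddCommGroup M] [Module ℂ M] (f : Module.Dual ℂ M) :
    ∀ (n : ℕ) (v : Fin (n + 1) → M),
      contractLeft (Q := 0) f (ExteriorAlgebra.ιMulti ℂ (n + 1) v) =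
        ∑ j : Fin (n + 1), (-1 : ℂ) ^ (j : ℕ) •
          (f (v j) • ExteriorAlgebra.ιMulti ℂ n fun l => v (j.succAbove l))
  | 0, v => by
    rw [ExteriorAlgebra.ιMulti_succ_apply, contractLeft_ι_mul]
    simp [ExteriorAlgebra.ιMulti_zero_apply]
  | n + 1, v => by
    rw [ExteriorAlgebra.ιMulti_succ_apply, contractLeft_ι_mul, contractLeft_ιMulti f n,
      sub_eq_add_neg]
    conv_rhs => rw [Fin.sum_univ_succ]
    congr 1
    · simp [Matrix.vecTail, Function.comp_def]
    · rw [Finset.mul_sum, ← Finset.sum_neg_distrib]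
      refine Finset.sum_congr rfl fun j _ => ?_
      rw [ExteriorAlgebra.ιMulti_succ_apply]
      simp [Matrix.vecTail, Function.comp_def, pow_succ]

variable {d : ℕ}

/-- Contraction by a coordinate is the contraction of the exterior algebra. -/
theorem coe_contract (i : Fin d) (k : ℕ) (x : ⋀[ℂ]^(k + 1) (Fin d → ℂ)) :
    (contract i k x : ExteriorAlgebra ℂ (Fin d → ℂ)) =
      CliffordAlgebra.contractLeft (Q := 0) (LinearMap.proj i)
        (x : ExteriorAlgebra ℂ (Fin d → ℂ)) := by
  have h : (⋀[ℂ]^k (Fin d → ℂ)).subtype ∘ₗ contract i k =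
      CliffordAlgebra.contractLeft (Q := 0) (LinearMap.proj i) ∘ₗ
        (⋀[ℂ]^(k + 1) (Fin d → ℂ)).subtype := by
    refine exteriorPower.linearMap_ext (AlternatingMap.ext fun v => ?_)
    simp only [LinearMap.compAlternatingMap_apply, LinearMap.comp_apply, contract,
      exteriorPower.alternatingMapLinearEquiv_apply_ιMulti, Submodule.subtype_apply,
      AlternatingMap.alternatizeUncurryFin_apply, exteriorPower.ιMulti_apply_coe,
      contractLeft_ιMulti]
    rw [AddSubmonoidClass.coe_finsetSum]
    refine Finset.sum_congr rfl fun j _ => ?_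
    rcases Nat.even_or_odd (j : ℕ) with h | h <;> simp [h.neg_one_pow] <;> rfl
  exact LinearMap.congr_fun h x

/-- Exterior multiplication by the `i`-th basis vector. -/
def wedge (i : Fin d) (k : ℕ) : ⋀[ℂ]^k (Fin d → ℂ) →ₗ[ℂ] ⋀[ℂ]^(k + 1) (Fin d → ℂ) :=
  (LinearMap.mulLeft ℂ (ExteriorAlgebra.ι ℂ (Pi.single i 1 : Fin d → ℂ))).restrict fun x hx => by
    change _ ∈ LinearMap.range (ExteriorAlgebra.ι ℂ) ^ (k + 1)
    rw [pow_succ']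
    exact Submodule.mul_mem_mul ⟨_, rfl⟩ hx

theorem coe_wedge (i : Fin d) (k : ℕ) (x : ⋀[ℂ]^k (Fin d → ℂ)) :
    (wedge i k x : ExteriorAlgebra ℂ (Fin d → ℂ)) =
      ExteriorAlgebra.ι ℂ (Pi.single i 1 : Fin d → ℂ) * x := rfl

/-- The canonical anticommutation relations; they are the antiderivation rule for a product with a
vector. -/
theorem contract_wedge_add (i j : Fin d) (k : ℕ) (x : ⋀[ℂ]^(k + 1) (Fin d → ℂ)) :
    contract i (k + 1) (wedge j (k + 1) x) + wedge j k (contract i k x) =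
      if i = j then x else 0 := by
  apply Subtype.ext
  rw [Submodule.coe_add, coe_contract, coe_wedge, coe_wedge, coe_contract,
    CliffordAlgebra.contractLeft_ι_mul, sub_add_cancel]
  by_cases h : i = j
  · subst h; simp
  · simp [h]

/-- The degree-zero case of the anticommutation relations: the second term is absent because
contraction kills scalars. -/
theorem contract_wedge_zero (i j : Fin d) (x : ⋀[ℂ]^0 (Fin d → ℂ)) :
    contract i 0 (wedge j 0 x) = if i = j then x else 0 := by
  obtain ⟨c, hc⟩ : ∃ c : ℂ, algebraMap ℂ (ExteriorAlgebra ℂ (Fin d → ℂ)) c = x := by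
    have h := x.2
    change _ ∈ LinearMap.range (ExteriorAlgebra.ι ℂ) ^ 0 at h
    rw [pow_zero] at h
    exact Submodule.mem_one.mp h
  apply Subtype.ext
  rw [coe_contract, coe_wedge, CliffordAlgebra.contractLeft_ι_mul, ← hc,
    CliffordAlgebra.contractLeft_algebraMap, mul_zero, sub_zero, hc]
  by_cases h : i = j
  · subst h; simp
  · simp [h]

/-- The number operator. In the induction, contracting the first factor contributes `∑ v₀(i) e_i =
v₀`, and moving `e_i` past `v₀` cancels the sign of the antiderivation rule. -/
theorem sum_ι_mul_contractLeft :
    ∀ (k : ℕ) (v : Fin k → Fin d → ℂ),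
      ∑ i : Fin d, ExteriorAlgebra.ι ℂ (Pi.single i 1 : Fin d → ℂ) *
        CliffordAlgebra.contractLeft (Q := 0) (LinearMap.proj i)
          (ExteriorAlgebra.ιMulti ℂ k v) = (k : ℂ) • ExteriorAlgebra.ιMulti ℂ k v
  | 0, v => by simp [ExteriorAlgebra.ιMulti_zero_apply, CliffordAlgebra.contractLeft_one]
  | k + 1, v => by
    have h := sum_ι_mul_contractLeft k (Matrix.vecTail v)
    rw [ExteriorAlgebra.ιMulti_succ_apply]
    set b := ExteriorAlgebra.ιMulti ℂ k (Matrix.vecTail v)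
    have h1 : ∀ i : Fin d, ExteriorAlgebra.ι ℂ (Pi.single i 1 : Fin d → ℂ) *
        CliffordAlgebra.contractLeft (Q := 0) (LinearMap.proj i) (ExteriorAlgebra.ι ℂ (v 0) * b) =
        ExteriorAlgebra.ι ℂ (v 0 i • (Pi.single i 1 : Fin d → ℂ)) * b +
        ExteriorAlgebra.ι ℂ (v 0) * (ExteriorAlgebra.ι ℂ (Pi.single i 1 : Fin d → ℂ) *
          CliffordAlgebra.contractLeft (Q := 0) (LinearMap.proj i) b) := by
      intro i
      have h2 := ExteriorAlgebra.ι_add_mul_swap (R := ℂ) (Pi.single i 1 : Fin d → ℂ) (v 0)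
      rw [CliffordAlgebra.contractLeft_ι_mul, mul_sub, ← mul_assoc, ← mul_assoc,
        eq_neg_of_add_eq_zero_left h2, map_smul]
      simp
    simp only [h1]
    rw [Finset.sum_add_distrib, ← Finset.sum_mul, ← Finset.mul_sum, h, ← map_sum,
      ← pi_eq_sum_univ' (v 0)]
    push_cast
    rw [add_smul, one_smul, mul_smul_comm, add_comm]

theorem sum_wedge_contract (k : ℕ) (x : ⋀[ℂ]^(k + 1) (Fin d → ℂ)) :
    ∑ i : Fin d, wedge i k (contract i k x) = ((k + 1 : ℕ) : ℂ) • x := by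
  have h : ∑ i : Fin d, wedge i k ∘ₗ contract i k = ((k + 1 : ℕ) : ℂ) • LinearMap.id := by
    refine exteriorPower.linearMap_ext (AlternatingMap.ext fun v => Subtype.ext ?_)
    simp only [LinearMap.compAlternatingMap_apply, LinearMap.sum_apply, LinearMap.comp_apply,
      LinearMap.smul_apply, LinearMap.id_apply]
    rw [AddSubmonoidClass.coe_finsetSum]
    simp only [coe_wedge, coe_contract, exteriorPower.ιMulti_apply_coe, Submodule.coe_smul]
    exact sum_ι_mul_contractLeft (k + 1) v
  simpa using LinearMap.congr_fun h x

theorem contract_contract (i j : Fin d) (k : ℕ) (x : ⋀[ℂ]^(k + 2) (Fin d → ℂ)) :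
    contract i k (contract j (k + 1) x) = -contract j k (contract i (k + 1) x) := by
  apply Subtype.ext
  rw [Submodule.coe_neg, coe_contract, coe_contract, coe_contract, coe_contract,
    CliffordAlgebra.contractLeft_comm]

end Exterior

/-! ### The Koszul complex and contracting homotopies. -/

section KoszulHomotopy

variable {d : ℕ} {V : Type*} [AddCommGroup V] [Module ℂ V] [Module (PolyRing d) V]
  [IsScalarTower ℂ (PolyRing d) V]

theorem koszulD_tmul' (k : ℕ) (v : V) (x : ⋀[ℂ]^(k + 1) (Fin d → ℂ)) :
    koszulD V k (v ⊗ₜ x) =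
      ∑ i : Fin d, ((MvPolynomial.X i : PolyRing d) • v) ⊗ₜ[ℂ] contract i k x := by
  simp [koszulD]

theorem koszulD_koszulD (k : ℕ) (w : V ⊗[ℂ] ⋀[ℂ]^(k + 2) (Fin d → ℂ)) :
    koszulD V k (koszulD V (k + 1) w) = 0 := by
  induction w using TensorProduct.induction_on with
  | zero => simp
  | add x y hx hy => rw [map_add, map_add, hx, hy, add_zero]
  | tmul v x =>
    simp only [koszulD_tmul', map_sum]
    have h : ∀ T : V ⊗[ℂ] ⋀[ℂ]^k (Fin d → ℂ), T = -T → T = 0 := fun T hT => by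
      have h2 : (2 : ℂ) • T = 0 := by rw [two_smul]; nth_rewrite 1 [hT]; exact neg_add_cancel T
      exact (smul_eq_zero.mp h2).resolve_left two_ne_zero
    -- Exchanging the two summation indices negates the double sum, since coordinates commute and
    -- contractions anticommute.
    apply h
    conv_lhs => rw [Finset.sum_comm]
    rw [← Finset.sum_neg_distrib]
    refine Finset.sum_congr rfl fun i _ => ?_
    rw [← Finset.sum_neg_distrib]
    refine Finset.sum_congr rfl fun j _ => ?_
    rw [contract_contract, TensorProduct.tmul_neg, smul_smul, smul_smul, mul_comm]

/-- A contracting homotopy in positive degrees makes the Koszul complex exact there. -/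
theorem koszulD_exact_of_homotopy (R : ℕ → Fin d → V →ₗ[ℂ] V) (S : ℕ → V →ₗ[ℂ] V)
    (h1 : ∀ k v, ∑ i, (MvPolynomial.X i : PolyRing d) • R (k + 1) i v +
      ((k + 1 : ℕ) : ℂ) • S (k + 1) v = v)
    (h2 : ∀ k i j v, R k j ((MvPolynomial.X i : PolyRing d) • v) =
      (MvPolynomial.X i : PolyRing d) • R (k + 1) j v + if i = j then S (k + 1) v else 0)
    (k : ℕ) : Function.Exact (koszulD (d := d) V (k + 1)) (koszulD (d := d) V k) := by
  -- With `R k j` a rescaled `∂/∂z_j`, this is a rescaled exterior derivative.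
  let h (k : ℕ) : V ⊗[ℂ] ⋀[ℂ]^k (Fin d → ℂ) →ₗ[ℂ] V ⊗[ℂ] ⋀[ℂ]^(k + 1) (Fin d → ℂ) :=
    ∑ j, TensorProduct.map (R k j) (wedge j k)
  have hh : ∀ (k : ℕ) (v : V) (x : ⋀[ℂ]^k (Fin d → ℂ)),
      h k (v ⊗ₜ x) = ∑ j, R k j v ⊗ₜ wedge j k x := fun k v x => by simp [h]
  have key : ∀ w, koszulD V (k + 1) (h (k + 1) w) + h k (koszulD V k w) = w := by
    intro w
    induction w using TensorProduct.induction_on with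
    | zero => simp
    | add x y hx hy =>
      rw [map_add, map_add, map_add, map_add, add_add_add_comm, hx, hy]
    | tmul v x =>
      simp only [koszulD_tmul', hh, map_sum]
      rw [Finset.sum_comm, ← Finset.sum_add_distrib]
      have h3 : ∀ i : Fin d,
          (∑ j, ((MvPolynomial.X i : PolyRing d) • R (k + 1) j v) ⊗ₜ[ℂ]
              contract i (k + 1) (wedge j (k + 1) x)) +
            ∑ j, R k j ((MvPolynomial.X i : PolyRing d) • v) ⊗ₜ[ℂ] wedge j k (contract i k x) =
          ((MvPolynomial.X i : PolyRing d) • R (k + 1) i v) ⊗ₜ[ℂ] x +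
            S (k + 1) v ⊗ₜ[ℂ] wedge i k (contract i k x) := by
        intro i
        -- `h2` replaces `R k` by `R (k + 1)`, so both terms carry the same operator. The
        -- anticommutation relations then kill every `j ≠ i`, and the commutator term `S` survives
        -- only for `j = i`.
        have h4 : ∀ j, ((MvPolynomial.X i : PolyRing d) • R (k + 1) j v) ⊗ₜ[ℂ]
              contract i (k + 1) (wedge j (k + 1) x) +
              R k j ((MvPolynomial.X i : PolyRing d) • v) ⊗ₜ[ℂ] wedge j k (contract i k x) =
            (if i = j then ((MvPolynomial.X i : PolyRing d) • R (k + 1) i v) ⊗ₜ[ℂ] x +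
              S (k + 1) v ⊗ₜ[ℂ] wedge i k (contract i k x) else 0) := by
          intro j
          rw [h2, TensorProduct.add_tmul, ← add_assoc, ← TensorProduct.tmul_add,
            contract_wedge_add]
          by_cases hij : i = j
          · subst hij; simp
          · simp [hij]
        rw [← Finset.sum_add_distrib, Finset.sum_congr rfl fun j _ => h4 j]
        simp
      rw [Finset.sum_congr rfl fun i _ => h3 i, Finset.sum_add_distrib,
        ← TensorProduct.tmul_sum, sum_wedge_contract, ← TensorProduct.sum_tmul,
        TensorProduct.tmul_smul, TensorProduct.smul_tmul', ← TensorProduct.add_tmul, h1]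
  intro w
  constructor
  · intro hw
    exact ⟨h (k + 1) w, by simpa [hw] using key w⟩
  · rintro ⟨u, rfl⟩
    exact koszulD_koszulD k u

end KoszulHomotopy

/-! ### Homological algebra: dimension shifting and Koszul homology from a resolution. -/

section Homology

/-- A linear relation between the cycles of two complexes that is total on both sides and matches
the boundaries induces an isomorphism in homology. -/
theorem nonempty_homologyAt_equiv_of_relation {A B C A' B' C' : Type*}
    [AddCommGroup A] [AddCommGroup B] [AddCommGroup C] [Module ℂ A] [Module ℂ B] [Module ℂ C]
    [AddCommGroup A'] [AddCommGroup B'] [AddCommGroup C'] [Module ℂ A'] [Module ℂ B'] [Module ℂ C']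
    (f : A →ₗ[ℂ] B) (g : B →ₗ[ℂ] C) (f' : A' →ₗ[ℂ] B') (g' : B' →ₗ[ℂ] C')
    (G : Submodule ℂ (B × B'))
    (hG : ∀ x y, (x, y) ∈ G → g x = 0) (hG' : ∀ x y, (x, y) ∈ G → g' y = 0)
    (hl : ∀ x, g x = 0 → ∃ y, (x, y) ∈ G) (hr : ∀ y, g' y = 0 → ∃ x, (x, y) ∈ G)
    (hb : ∀ x y, (x, y) ∈ G → ((∃ a, f a = x) ↔ ∃ a', f' a' = y)) :
    Nonempty (HomologyAt f g ≃ₗ[ℂ] HomologyAt f' g') := by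
  -- Both homology spaces are quotients of `G`, and `hb` says that the two quotient maps have the
  -- same kernel.
  let p : G →ₗ[ℂ] HomologyAt f g := Submodule.mkQ _ ∘ₗ
    (LinearMap.fst ℂ B B' ∘ₗ G.subtype).codRestrict (LinearMap.ker g) fun c => hG _ c.1.2 c.2
  let p' : G →ₗ[ℂ] HomologyAt f' g' := Submodule.mkQ _ ∘ₗ
    (LinearMap.snd ℂ B B' ∘ₗ G.subtype).codRestrict (LinearMap.ker g') fun c => hG' c.1.1 _ c.2
  have hp : Function.Surjective p := by
    rintro ⟨x⟩
    obtain ⟨y, hy⟩ := hl x x.2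
    exact ⟨⟨(x, y), hy⟩, rfl⟩
  have hp' : Function.Surjective p' := by
    rintro ⟨y⟩
    obtain ⟨x, hx⟩ := hr y y.2
    exact ⟨⟨(x, y), hx⟩, rfl⟩
  have hk : LinearMap.ker p = LinearMap.ker p' := by
    ext c
    have h1 : p c = 0 ↔ ∃ a, f a = c.1.1 := Submodule.Quotient.mk_eq_zero _
    have h2 : p' c = 0 ↔ ∃ a, f' a = c.1.2 := Submodule.Quotient.mk_eq_zero _
    rw [LinearMap.mem_ker, LinearMap.mem_ker, h1, h2]
    exact hb _ _ c.2
  exact ⟨(p.quotKerEquivOfSurjective hp).symm ≪≫ₗ Submodule.quotEquivOfEq _ _ hk ≪≫ₗ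
    p'.quotKerEquivOfSurjective hp'⟩

variable {d : ℕ}

section Functoriality

variable {M N P : Type*} [AddCommGroup M] [Module ℂ M] [Module (PolyRing d) M]
  [IsScalarTower ℂ (PolyRing d) M] [AddCommGroup N] [Module ℂ N] [Module (PolyRing d) N]
  [IsScalarTower ℂ (PolyRing d) N] [AddCommGroup P] [Module ℂ P] [Module (PolyRing d) P]
  [IsScalarTower ℂ (PolyRing d) P]

/-- The map of Koszul complexes induced by a module homomorphism. -/
def koszulMap (f : M →ₗ[PolyRing d] N) (k : ℕ) :
    M ⊗[ℂ] ⋀[ℂ]^k (Fin d → ℂ) →ₗ[ℂ] N ⊗[ℂ] ⋀[ℂ]^k (Fin d → ℂ) :=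
  (f.restrictScalars ℂ).rTensor _

theorem koszulMap_koszulD (f : M →ₗ[PolyRing d] N) (k : ℕ)
    (w : M ⊗[ℂ] ⋀[ℂ]^(k + 1) (Fin d → ℂ)) :
    koszulMap f k (koszulD M k w) = koszulD N k (koszulMap f (k + 1) w) := by
  induction w using TensorProduct.induction_on with
  | zero => simp
  | add x y hx hy => simp only [map_add, hx, hy]
  | tmul v x => simp [koszulD_tmul', koszulMap]

theorem koszulMap_exact {f : M →ₗ[PolyRing d] N} {g : N →ₗ[PolyRing d] P}
    (h : Function.Exact f g) (k : ℕ) : Function.Exact (koszulMap f k) (koszulMap g k) :=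
  Module.Flat.rTensor_exact (R := ℂ) _ (f := f.restrictScalars ℂ) (g := g.restrictScalars ℂ) h

theorem koszulMap_surjective {f : M →ₗ[PolyRing d] N} (h : Function.Surjective f) (k : ℕ) :
    Function.Surjective (koszulMap f k) :=
  LinearMap.rTensor_surjective (g := f.restrictScalars ℂ) _ h

theorem koszulMap_injective {f : M →ₗ[PolyRing d] N} (h : Function.Injective f) (k : ℕ) :
    Function.Injective (koszulMap f k) :=
  Module.Flat.rTensor_preserves_injective_linearMap (f.restrictScalars ℂ) h

/-- Dimension shifting along a short exact sequence whose middle term is Koszul acyclic in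
positive degrees. -/
theorem nonempty_koszul_homology_equiv_shift {f : M →ₗ[PolyRing d] N} {g : N →ₗ[PolyRing d] P}
    (hf : Function.Injective f) (hfg : Function.Exact f g) (hg : Function.Surjective g)
    (hN : ∀ k, Function.Exact (koszulD (d := d) N (k + 1)) (koszulD (d := d) N k)) (k : ℕ) :
    Nonempty (HomologyAt (koszulD (d := d) P (k + 2)) (koszulD (d := d) P (k + 1)) ≃ₗ[ℂ]
      HomologyAt (koszulD (d := d) M (k + 1)) (koszulD (d := d) M k)) := by
  -- The connecting homomorphism as a relation on cycles, which avoids choosing lifts: `x` lifts to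
  -- `w`, and the boundary of `w` comes from `y`.
  let G : Submodule ℂ
      ((P ⊗[ℂ] ⋀[ℂ]^(k + 2) (Fin d → ℂ)) × (M ⊗[ℂ] ⋀[ℂ]^(k + 1) (Fin d → ℂ))) :=
    { carrier := {c | ∃ w, koszulMap g (k + 2) w = c.1 ∧
        koszulD N (k + 1) w = koszulMap f (k + 1) c.2}
      zero_mem' := ⟨0, by simp⟩
      add_mem' := by
        rintro _ _ ⟨w, h1, h2⟩ ⟨w', h1', h2'⟩
        exact ⟨w + w', by simp [h1, h1'], by simp [h2, h2']⟩
      smul_mem' := by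
        rintro a _ ⟨w, h1, h2⟩
        exact ⟨a • w, by simp [h1], by simp [h2]⟩ }
  refine nonempty_homologyAt_equiv_of_relation _ _ _ _ G ?_ ?_ ?_ ?_ ?_
  · rintro x y ⟨w, rfl, h2⟩
    rw [← koszulMap_koszulD, h2]
    exact (koszulMap_exact hfg _).apply_apply_eq_zero y
  · rintro x y ⟨w, rfl, h2⟩
    apply koszulMap_injective hf
    rw [koszulMap_koszulD, ← h2, map_zero, koszulD_koszulD]
  · intro x hx
    obtain ⟨w, rfl⟩ := koszulMap_surjective hg _ x
    rw [← koszulMap_koszulD] at hx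
    obtain ⟨y, hy⟩ := (koszulMap_exact hfg _ _).mp hx
    exact ⟨y, w, rfl, hy.symm⟩
  · intro y hy
    have h : koszulD N k (koszulMap f (k + 1) y) = 0 := by rw [← koszulMap_koszulD, hy, map_zero]
    obtain ⟨w, hw⟩ := (hN k _).mp h
    exact ⟨_, w, rfl, hw⟩
  · rintro x y ⟨w, rfl, h2⟩
    simp only at h2 ⊢
    constructor
    · rintro ⟨a, ha⟩
      obtain ⟨u, rfl⟩ := koszulMap_surjective hg _ a
      have h3 : koszulMap g (k + 2) (w - koszulD N (k + 2) u) = 0 := by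
        rw [map_sub, koszulMap_koszulD, ha, sub_self]
      obtain ⟨v, hv⟩ := (koszulMap_exact hfg _ _).mp h3
      refine ⟨v, koszulMap_injective hf _ ?_⟩
      rw [koszulMap_koszulD, hv, map_sub, koszulD_koszulD, sub_zero, h2]
    · rintro ⟨v, rfl⟩
      have h3 : koszulD N (k + 1) (w - koszulMap f (k + 2) v) = 0 := by
        rw [map_sub, h2, koszulMap_koszulD, sub_self]
      obtain ⟨u, hu⟩ := (hN _ _).mp h3
      refine ⟨koszulMap g _ u, ?_⟩
      rw [← koszulMap_koszulD, hu, map_sub, (koszulMap_exact hfg _).apply_apply_eq_zero v,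
        sub_zero]

end Functoriality

section Resolution

variable {M : Type*} [AddCommGroup M] [Module ℂ M] [Module (PolyRing d) M]
  [IsScalarTower ℂ (PolyRing d) M]

/-- The base case of dimension shifting. In degree one the connecting map only identifies the
homology with a kernel inside zeroth homology, so two further terms of the resolution enter. The
hypotheses on `ε` and `ψ` identify `Y n` with the zeroth Koszul homology of `F n`, and `ψ n` with
the map that `φ n` induces there. -/
theorem nonempty_koszul_homology_one_equiv
    {F : ℕ → Type*} [∀ n, AddCommGroup (F n)] [∀ n, Module ℂ (F n)]
    [∀ n, Module (PolyRing d) (F n)] [∀ n, IsScalarTower ℂ (PolyRing d) (F n)]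
    {Y : ℕ → Type*} [∀ n, AddCommGroup (Y n)] [∀ n, Module ℂ (Y n)]
    (φ : ∀ n, F (n + 1) →ₗ[PolyRing d] F n) (aug : F 0 →ₗ[PolyRing d] M)
    (hφ : ∀ n, Function.Exact (φ (n + 1)) (φ n)) (hφa : Function.Exact (φ 0) aug)
    (ha : Function.Surjective aug)
    (hF : ∀ n k, Function.Exact (koszulD (d := d) (F n) (k + 1)) (koszulD (d := d) (F n) k))
    (ψ : ∀ n, Y (n + 1) →ₗ[ℂ] Y n) (ε : ∀ n, F n ⊗[ℂ] ⋀[ℂ]^0 (Fin d → ℂ) →ₗ[ℂ] Y n)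
    (hε : ∀ n, Function.Surjective (ε n))
    (hεd : ∀ n, Function.Exact (koszulD (d := d) (F n) 0) (ε n))
    (hψ : ∀ n w, ε n (koszulMap (φ n) 0 w) = ψ n (ε (n + 1) w)) :
    Nonempty (HomologyAt (koszulD (d := d) M 1) (koszulD (d := d) M 0) ≃ₗ[ℂ]
      HomologyAt (ψ 1) (ψ 0)) := by
  -- A staircase in the double complex: lift `x` to `w`, take its boundary, lift that along `φ 0` to
  -- `v`, and pass to the class `y` of `v`.
  let G : Submodule ℂ ((M ⊗[ℂ] ⋀[ℂ]^1 (Fin d → ℂ)) × Y 1) :=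
    { carrier := {c | ∃ w v, koszulMap aug 1 w = c.1 ∧
        koszulD (F 0) 0 w = koszulMap (φ 0) 0 v ∧ ε 1 v = c.2}
      zero_mem' := ⟨0, 0, by simp⟩
      add_mem' := by
        rintro _ _ ⟨w, v, h1, h2, h3⟩ ⟨w', v', h1', h2', h3'⟩
        exact ⟨w + w', v + v', by simp [h1, h1'], by simp [h2, h2'], by simp [h3, h3']⟩
      smul_mem' := by
        rintro a _ ⟨w, v, h1, h2, h3⟩
        exact ⟨a • w, a • v, by simp [h1], by simp [h2], by simp [h3]⟩ }
  refine nonempty_homologyAt_equiv_of_relation _ _ _ _ G ?_ ?_ ?_ ?_ ?_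
  · rintro x y ⟨w, v, rfl, h2, rfl⟩
    rw [← koszulMap_koszulD, h2]
    exact (koszulMap_exact hφa _).apply_apply_eq_zero v
  · rintro x y ⟨w, v, rfl, h2, rfl⟩
    rw [← hψ, ← h2]
    exact (hεd 0).apply_apply_eq_zero w
  · intro x hx
    obtain ⟨w, rfl⟩ := koszulMap_surjective ha _ x
    rw [← koszulMap_koszulD] at hx
    obtain ⟨v, hv⟩ := (koszulMap_exact hφa _ _).mp hx
    exact ⟨_, w, v, rfl, hv.symm, rfl⟩
  · intro y hy
    obtain ⟨v, rfl⟩ := hε 1 y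
    rw [← hψ] at hy
    obtain ⟨w, hw⟩ := (hεd 0 _).mp hy
    exact ⟨_, w, v, rfl, hw, rfl⟩
  · rintro x y ⟨w, v, rfl, h2, rfl⟩
    constructor
    · rintro ⟨a, ha'⟩
      obtain ⟨u, rfl⟩ := koszulMap_surjective ha _ a
      have h3 : koszulMap aug 1 (w - koszulD (F 0) 1 u) = 0 := by
        rw [map_sub, koszulMap_koszulD, ha', sub_self]
      obtain ⟨t, ht⟩ := (koszulMap_exact hφa _ _).mp h3
      have h4 : koszulMap (φ 0) 0 (v - koszulD (F 1) 0 t) = 0 := by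
        rw [map_sub, koszulMap_koszulD, ht, map_sub, koszulD_koszulD, sub_zero, h2, sub_self]
      obtain ⟨s, hs⟩ := (koszulMap_exact (hφ 0) _ _).mp h4
      refine ⟨ε 2 s, ?_⟩
      rw [← hψ, hs, map_sub, (hεd 1).apply_apply_eq_zero t, sub_zero]
    · rintro ⟨y', hy'⟩
      obtain ⟨s, rfl⟩ := hε 2 y'
      have h3 : ε 1 (v - koszulMap (φ 1) 0 s) = 0 := by rw [map_sub, hψ, hy', sub_self]
      obtain ⟨t, ht⟩ := (hεd 1 _).mp h3
      have h4 : koszulD (F 0) 0 (w - koszulMap (φ 0) 1 t) = 0 := by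
        rw [map_sub, ← koszulMap_koszulD, ht, map_sub,
          (koszulMap_exact (hφ 0) _).apply_apply_eq_zero s, sub_zero, h2, sub_self]
      obtain ⟨u, hu⟩ := (hF 0 0 _).mp h4
      refine ⟨koszulMap aug _ u, ?_⟩
      rw [← koszulMap_koszulD, hu, map_sub, (koszulMap_exact hφa _).apply_apply_eq_zero t,
        sub_zero]

end Resolution

universe u v w

/-- The Koszul homology of `M` in positive degrees is computed by any resolution of `M` by modules
`F n` that are Koszul acyclic in positive degrees, with zeroth Koszul homology `Y n`. -/
theorem nonempty_koszul_homology_equiv (k : ℕ) :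
    ∀ {M : Type u} [AddCommGroup M] [Module ℂ M] [Module (PolyRing d) M]
    [IsScalarTower ℂ (PolyRing d) M]
    {F : ℕ → Type v} [∀ n, AddCommGroup (F n)] [∀ n, Module ℂ (F n)]
    [∀ n, Module (PolyRing d) (F n)] [∀ n, IsScalarTower ℂ (PolyRing d) (F n)]
    {Y : ℕ → Type w} [∀ n, AddCommGroup (Y n)] [∀ n, Module ℂ (Y n)]
    (φ : ∀ n, F (n + 1) →ₗ[PolyRing d] F n) (aug : F 0 →ₗ[PolyRing d] M)
    (_ : ∀ n, Function.Exact (φ (n + 1)) (φ n)) (_ : Function.Exact (φ 0) aug)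
    (_ : Function.Surjective aug)
    (_ : ∀ n k, Function.Exact (koszulD (d := d) (F n) (k + 1)) (koszulD (d := d) (F n) k))
    (ψ : ∀ n, Y (n + 1) →ₗ[ℂ] Y n) (ε : ∀ n, F n ⊗[ℂ] ⋀[ℂ]^0 (Fin d → ℂ) →ₗ[ℂ] Y n)
    (_ : ∀ n, Function.Surjective (ε n))
    (_ : ∀ n, Function.Exact (koszulD (d := d) (F n) 0) (ε n))
    (_ : ∀ n w, ε n (koszulMap (φ n) 0 w) = ψ n (ε (n + 1) w)),
    Nonempty (HomologyAt (koszulD (d := d) M (k + 1)) (koszulD (d := d) M k) ≃ₗ[ℂ]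
      HomologyAt (ψ (k + 1)) (ψ k)) := by
  -- A shift replaces `M` by `ker aug`, which lives in the universe of `F`. The induction therefore
  -- runs with `M` in that universe, and a general `M` costs one separate shift.
  suffices H : ∀ k, ∀ {M : Type v} [AddCommGroup M] [Module ℂ M] [Module (PolyRing d) M]
      [IsScalarTower ℂ (PolyRing d) M]
      {F : ℕ → Type v} [∀ n, AddCommGroup (F n)] [∀ n, Module ℂ (F n)]
      [∀ n, Module (PolyRing d) (F n)] [∀ n, IsScalarTower ℂ (PolyRing d) (F n)]
      {Y : ℕ → Type w} [∀ n, AddCommGroup (Y n)] [∀ n, Module ℂ (Y n)]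
      (φ : ∀ n, F (n + 1) →ₗ[PolyRing d] F n) (aug : F 0 →ₗ[PolyRing d] M)
      (_ : ∀ n, Function.Exact (φ (n + 1)) (φ n)) (_ : Function.Exact (φ 0) aug)
      (_ : Function.Surjective aug)
      (_ : ∀ n k, Function.Exact (koszulD (d := d) (F n) (k + 1)) (koszulD (d := d) (F n) k))
      (ψ : ∀ n, Y (n + 1) →ₗ[ℂ] Y n) (ε : ∀ n, F n ⊗[ℂ] ⋀[ℂ]^0 (Fin d → ℂ) →ₗ[ℂ] Y n)
      (_ : ∀ n, Function.Surjective (ε n))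
      (_ : ∀ n, Function.Exact (koszulD (d := d) (F n) 0) (ε n))
      (_ : ∀ n w, ε n (koszulMap (φ n) 0 w) = ψ n (ε (n + 1) w)),
      Nonempty (HomologyAt (koszulD (d := d) M (k + 1)) (koszulD (d := d) M k) ≃ₗ[ℂ]
        HomologyAt (ψ (k + 1)) (ψ k)) by
    intro M _ _ _ _ F _ _ _ _ Y _ _ φ aug hφ hφa ha hF ψ ε hε hεd hψ
    cases k with
    | zero => exact nonempty_koszul_homology_one_equiv φ aug hφ hφa ha hF ψ ε hε hεd hψ
    | succ k =>
      obtain ⟨e⟩ := nonempty_koszul_homology_equiv_shift (f := (LinearMap.ker aug).subtype)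
        Subtype.val_injective (LinearMap.exact_subtype_ker_map aug) ha (hF 0) k
      obtain ⟨e'⟩ := H k (fun n => φ (n + 1))
        ((φ 0).codRestrict (LinearMap.ker aug) hφa.apply_apply_eq_zero) (fun n => hφ (n + 1))
        (fun x => by rw [← hφ 0 x, ← Subtype.coe_inj]; rfl)
        (fun x => by
          obtain ⟨y, hy⟩ := (hφa x).mp x.2
          exact ⟨y, Subtype.ext hy⟩)
        (fun n => hF (n + 1)) (fun n => ψ (n + 1)) (fun n => ε (n + 1)) (fun n => hε (n + 1))
        (fun n => hεd (n + 1)) (fun n => hψ (n + 1))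
      exact ⟨e ≪≫ₗ e'⟩
  intro k
  induction k with
  | zero =>
    intro M _ _ _ _ F _ _ _ _ Y _ _ φ aug hφ hφa ha hF ψ ε hε hεd hψ
    exact nonempty_koszul_homology_one_equiv φ aug hφ hφa ha hF ψ ε hε hεd hψ
  | succ k H =>
    intro M _ _ _ _ F _ _ _ _ Y _ _ φ aug hφ hφa ha hF ψ ε hε hεd hψ
    obtain ⟨e⟩ := nonempty_koszul_homology_equiv_shift (f := (LinearMap.ker aug).subtype)
      Subtype.val_injective (LinearMap.exact_subtype_ker_map aug) ha (hF 0) k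
    obtain ⟨e'⟩ := H (fun n => φ (n + 1))
      ((φ 0).codRestrict (LinearMap.ker aug) hφa.apply_apply_eq_zero) (fun n => hφ (n + 1))
      (fun x => by rw [← hφ 0 x, ← Subtype.coe_inj]; rfl)
      (fun x => by
        obtain ⟨y, hy⟩ := (hφa x).mp x.2
        exact ⟨y, Subtype.ext hy⟩)
      (fun n => hF (n + 1)) (fun n => ψ (n + 1)) (fun n => ε (n + 1)) (fun n => hε (n + 1))
      (fun n => hεd (n + 1)) (fun n => hψ (n + 1))
    exact ⟨e ≪≫ₗ e'⟩

end Homology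

/-! ### Operators on `H_d²`: diagonal operators, backward shifts, density of monomials. -/

/-- A bounded family of scalars defines a diagonal operator in an orthogonal total family. -/
theorem exists_diagonal {ι E : Type*} [NormedAddCommGroup E] [InnerProductSpace ℂ E]
    [CompleteSpace E] (m : ι → E) (horth : ∀ i j, i ≠ j → inner ℂ (m i) (m j) = 0)
    (hd : DenseRange (Finsupp.linearCombination ℂ m)) (l : ι → ℂ) (hl : ∀ i, ‖l i‖ ≤ 1) :
    ∃ T : E →L[ℂ] E, ∀ i, T (m i) = l i • m i := by
  have hn : ∀ (s : Finset ι) (g : ι → ℂ),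
      ‖∑ i ∈ s, g i • m i‖ ^ 2 = ∑ i ∈ s, ‖g i‖ ^ 2 * ‖m i‖ ^ 2 := by
    intro s g
    apply Complex.ofReal_injective
    have h := inner_self_eq_norm_sq_to_K (𝕜 := ℂ) (∑ i ∈ s, g i • m i)
    push_cast
    rw [← Complex.coe_algebraMap, ← h, sum_inner]
    refine Finset.sum_congr rfl fun i hi => ?_
    rw [inner_sum, Finset.sum_eq_single_of_mem i hi]
    · rw [inner_smul_left, inner_smul_right, inner_self_eq_norm_sq_to_K, ← mul_assoc,
        Complex.conj_mul']
      rfl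
    · intro j _ hj
      rw [inner_smul_left, inner_smul_right, horth i j hj.symm, mul_zero, mul_zero]
  let f : (ι →₀ ℂ) →ₗ[ℂ] E := Finsupp.linearCombination ℂ fun i => l i • m i
  have hf : ∀ c, ‖f c‖ ≤ 1 * ‖Finsupp.linearCombination ℂ m c‖ := by
    intro c
    have h1 : f c = ∑ i ∈ c.support, (c i * l i) • m i := by
      simp [f, Finsupp.linearCombination_apply, Finsupp.sum, mul_smul]
    rw [one_mul, h1, Finsupp.linearCombination_apply, Finsupp.sum]
    refine (sq_le_sq₀ (norm_nonneg _) (norm_nonneg _)).mp ?_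
    rw [hn, hn]
    refine Finset.sum_le_sum fun i _ => ?_
    rw [norm_mul]
    gcongr
    exact mul_le_of_le_one_right (norm_nonneg _) (hl i)
  refine ⟨f.extendOfNorm (Finsupp.linearCombination ℂ m), fun i => ?_⟩
  have h := LinearMap.extendOfNorm_eq hd ⟨1, hf⟩ (Finsupp.single i 1)
  simpa [f] using h

namespace DruryArveson

variable {d : ℕ}

/-- Bounded operators on `H_d²` that agree on the kernel functions are equal. -/
theorem clm_ext {E : Type*} [NormedAddCommGroup E] [NormedSpace ℂ E]
    {S T : DruryArveson d →L[ℂ] E} (h : ∀ w, S (k w) = T (k w)) : S = T := by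
  apply DFunLike.coe_injective
  refine denseRange_k.equalizer S.continuous T.continuous (funext fun c => ?_)
  simp [Finsupp.linearCombination_apply, Finsupp.sum, h]

/-- The backward shift `M_{z_i}^*`. -/
def backShift (i : Fin d) : DruryArveson d →L[ℂ] DruryArveson d :=
  (mulOp (MvPolynomial.X i)).adjoint

theorem backShift_k (i : Fin d) (w : UnitBall d) : backShift i (k w) = star (w.1 i) • k w := by
  refine ext_inner_left ℂ fun f => ?_
  rw [backShift, ContinuousLinearMap.adjoint_inner_right, ← inner_conj_symm, inner_k, mulOp_apply,
    inner_smul_right, ← inner_conj_symm f, inner_k]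
  simp

/-- As `M_i^* k_w = conj(w_i) k_w`, on kernel functions this is the equation `(1 - ⟨z, w⟩) k(z, w) =
1`, and kernel functions span a dense subspace. -/
theorem sum_mul_backShift (f : DruryArveson d) :
    ∑ i, (MvPolynomial.X i : PolyRing d) • backShift i f =
      f - f (UnitBall.zero d) • FreeModule.one d := by
  have h : ∑ i, mulOp (MvPolynomial.X i) ∘L backShift i =
      ContinuousLinearMap.id ℂ (DruryArveson d) -
        (innerSL ℂ (FreeModule.one d)).smulRight (FreeModule.one d) := by
    refine clm_ext fun w => RKHS.ext fun z => ?_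
    have h1 := daKer_mul z w
    have h2 : k w (UnitBall.zero d) = 1 := by
      simp [k_apply, daKer, UnitBall.zero]
    simp only [sum_apply, ContinuousLinearMap.comp_apply, backShift_k, map_smul,
      sub_apply, ContinuousLinearMap.smulRight_apply, innerSL_apply_apply,
      ContinuousLinearMap.id_apply, FreeModule.one, inner_k, h2, one_smul]
    rw [RKHS.coe_sub, Pi.sub_apply, ← inner_k z, inner_sum]
    simp only [inner_smul_right, inner_k, mulOp_apply, k_apply, MvPolynomial.eval_X]
    have h3 : daKer d z (UnitBall.zero d) = 1 := by simp [daKer, UnitBall.zero]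
    rw [h3]
    have h4 : ∑ i, star (w.1 i) * (z.1 i * daKer d z w) =
        daKer d z w * ∑ i, z.1 i * star (w.1 i) := by
      rw [Finset.mul_sum]
      exact Finset.sum_congr rfl fun i _ => by ring
    rw [h4]
    linear_combination -h1
  have h1 := DFunLike.congr_fun h f
  simpa [smul_eq_mulOp, FreeModule.one, inner_k] using h1

theorem inner_smul_X (i : Fin d) (f g : DruryArveson d) :
    inner ℂ f ((MvPolynomial.X i : PolyRing d) • g) = inner ℂ (backShift i f) g := by
  rw [backShift, ContinuousLinearMap.adjoint_inner_left, smul_eq_mulOp]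

theorem sum_norm_backShift_sq_le (f : DruryArveson d) :
    ∑ i, ‖backShift i f‖ ^ 2 ≤ ‖f‖ ^ 2 := by
  have h : ((∑ i, ‖backShift i f‖ ^ 2 : ℝ) : ℂ) =
      ((‖f‖ ^ 2 - ‖f (UnitBall.zero d)‖ ^ 2 : ℝ) : ℂ) := by
    have h1 : ∀ g : DruryArveson d, ((‖g‖ ^ 2 : ℝ) : ℂ) = inner ℂ g g := fun g => by
      rw [inner_self_eq_norm_sq_to_K]; push_cast; rfl
    rw [Complex.ofReal_sum, Complex.ofReal_sub, h1 f]
    simp only [h1, ← inner_smul_X]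
    rw [← inner_sum, sum_mul_backShift, inner_sub_right, inner_smul_right,
      ← inner_conj_symm f (FreeModule.one d), FreeModule.one, inner_k, Complex.mul_conj']
    push_cast
    rfl
  have h2 := Complex.ofReal_injective h
  rw [h2]
  linarith [sq_nonneg ‖f (UnitBall.zero d)‖]

/-- The linear polynomial `⟨z, w⟩ = ∑ i, conj (w i) z_i`. -/
def linPoly (w : UnitBall d) : PolyRing d :=
  ∑ i, MvPolynomial.C (star (w.1 i)) * MvPolynomial.X i

theorem C_smul (c : ℂ) (f : DruryArveson d) : (MvPolynomial.C c : PolyRing d) • f = c • f :=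
  RKHS.ext fun z => by simp [smul_apply]

theorem linPoly_smul (w : UnitBall d) (f : DruryArveson d) :
    linPoly w • f = ∑ i, star (w.1 i) • ((MvPolynomial.X i : PolyRing d) • f) := by
  simp only [linPoly, Finset.sum_smul, mul_smul, C_smul]

/-- In the pairing of `⟨z, w⟩ f` with itself, the coordinates move across as backward shifts, whose
squared norms sum to at most the square of the norm; Cauchy–Schwarz does the rest. The factor `‖w‖ <
1` gives convergence in `eq_zero_of_inner_mono`. -/
theorem norm_linPoly_smul_le (w : UnitBall d) (f : DruryArveson d) :
    ‖linPoly w • f‖ ≤ ‖w.1‖ * ‖f‖ := by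
  set h := linPoly w • f with hh
  have h1 : ‖h‖ ^ 2 ≤ ‖h‖ * (‖w.1‖ * ‖f‖) := by
    calc ‖h‖ ^ 2 = ‖inner ℂ h h‖ := by
          rw [inner_self_eq_norm_sq_to_K]; simp
      _ = ‖∑ i, star (w.1 i) * inner ℂ (backShift i h) f‖ := by
          conv_lhs => rw [hh, linPoly_smul, inner_sum]
          simp only [inner_smul_right, inner_smul_X, ← linPoly_smul, ← hh]
      _ ≤ ∑ i, ‖w.1 i‖ * ‖backShift i h‖ * ‖f‖ := by
          refine (norm_sum_le _ _).trans (Finset.sum_le_sum fun i _ => ?_)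
          rw [norm_mul, norm_star, mul_assoc]
          gcongr
          exact norm_inner_le_norm _ _
      _ = (∑ i, ‖w.1 i‖ * ‖backShift i h‖) * ‖f‖ := by rw [Finset.sum_mul]
      _ ≤ (√(∑ i, ‖w.1 i‖ ^ 2) * √(∑ i, ‖backShift i h‖ ^ 2)) * ‖f‖ := by
          gcongr
          exact Real.sum_mul_le_sqrt_mul_sqrt _ _ _
      _ ≤ (‖w.1‖ * ‖h‖) * ‖f‖ := by
          gcongr
          · rw [EuclideanSpace.norm_eq]
          · exact Real.sqrt_le_iff.mpr ⟨norm_nonneg _, sum_norm_backShift_sq_le h⟩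
      _ = _ := by ring
  rcases eq_or_lt_of_le (norm_nonneg h) with h0 | h0
  · rw [← h0]; positivity
  · rw [sq] at h1
    exact le_of_mul_le_mul_left h1 h0

theorem k_eq_add (w : UnitBall d) : k w = FreeModule.one d + linPoly w • k w := by
  have h := sum_mul_backShift (k w)
  have h2 : k w (UnitBall.zero d) = 1 := by simp [k_apply, daKer, UnitBall.zero]
  simp only [backShift_k, h2, one_smul] at h
  have h3 : linPoly w • k w = k w - FreeModule.one d := by
    rw [← h, linPoly_smul]
    exact Finset.sum_congr rfl fun i _ => smul_comm _ _ _
  rw [h3, add_sub_cancel]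

/-- The monomials `z^a`, as elements of `H_d²`. -/
def mono (a : Fin d →₀ ℕ) : DruryArveson d :=
  (MvPolynomial.monomial a 1 : PolyRing d) • FreeModule.one d

theorem smul_one_eq_sum (p : PolyRing d) :
    p • FreeModule.one d = ∑ a ∈ p.support, p.coeff a • mono a := by
  conv_lhs => rw [p.as_sum, Finset.sum_smul]
  refine Finset.sum_congr rfl fun a _ => ?_
  rw [mono, ← C_smul, smul_smul, MvPolynomial.C_mul_monomial, mul_one]

/-- Iterating `k_w = 1 + ⟨z, w⟩ k_w` writes `k_w` as a polynomial plus `⟨z, w⟩^n k_w`, a remainder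
of norm at most `‖w‖^n ‖k_w‖`. If `f` is orthogonal to polynomials, then `f(w)` is the pairing with
the remainder alone, which tends to `0`. -/
theorem eq_zero_of_inner_mono (f : DruryArveson d) (hf : ∀ a, inner ℂ (mono a) f = 0) :
    f = 0 := by
  refine RKHS.ext fun w => ?_
  have h1 : ∀ p : PolyRing d, inner ℂ (p • FreeModule.one d) f = 0 := fun p => by
    rw [smul_one_eq_sum, sum_inner]
    exact Finset.sum_eq_zero fun a _ => by rw [inner_smul_left, hf, mul_zero]
  have h2 : ∀ n : ℕ, inner ℂ (k w) f = inner ℂ (linPoly w ^ n • k w) f := by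
    intro n
    induction n with
    | zero => simp
    | succ n ih =>
      rw [ih]
      conv_lhs => rw [k_eq_add]
      rw [smul_add, inner_add_left, h1, zero_add, smul_smul, pow_succ]
  have h3 : ∀ n : ℕ, ‖linPoly w ^ n • k w‖ ≤ ‖w.1‖ ^ n * ‖k w‖ := by
    intro n
    induction n with
    | zero => simp
    | succ n ih =>
      rw [pow_succ', mul_smul, pow_succ', mul_assoc]
      exact (norm_linPoly_smul_le _ _).trans (by gcongr)
  have h4 : Filter.Tendsto (fun n : ℕ => ‖w.1‖ ^ n * ‖k w‖ * ‖f‖) Filter.atTop (nhds 0) := by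
    have := ((tendsto_pow_atTop_nhds_zero_of_lt_one (norm_nonneg w.1)
      (mem_ball_zero_iff.mp w.2)).mul_const ‖k w‖).mul_const ‖f‖
    simpa using this
  have h5 : ‖f w‖ ≤ 0 := by
    refine ge_of_tendsto' h4 fun n => ?_
    rw [← inner_k, h2 n]
    exact (norm_inner_le_norm _ _).trans (by gcongr; exact h3 n)
  rw [norm_le_zero_iff.mp h5]
  simp

theorem denseRange_mono :
    DenseRange (Finsupp.linearCombination ℂ (mono : (Fin d →₀ ℕ) → DruryArveson d)) := by
  have h : (Submodule.span ℂ (Set.range (mono (d := d))))ᗮ = ⊥ := by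
    rw [eq_bot_iff]
    intro f hf
    exact eq_zero_of_inner_mono f fun a =>
      (Submodule.mem_orthogonal _ _).mp hf _ (Submodule.subset_span ⟨a, rfl⟩)
  have h2 := (Submodule.topologicalClosure_eq_top_iff (K := Submodule.span ℂ
    (Set.range (mono (d := d))))).mpr h
  rw [← Finsupp.range_linearCombination] at h2
  rw [DenseRange, dense_iff_closure_eq]
  exact congrArg (fun S : Submodule ℂ (DruryArveson d) => (S : Set (DruryArveson d))) h2

theorem clm_ext_mono {E : Type*} [NormedAddCommGroup E] [NormedSpace ℂ E]
    {S T : DruryArveson d →L[ℂ] E} (h : ∀ a, S (mono a) = T (mono a)) : S = T := by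
  apply DFunLike.coe_injective
  refine denseRange_mono.equalizer S.continuous T.continuous (funext fun c => ?_)
  simp [Finsupp.linearCombination_apply, Finsupp.sum, h]

theorem mono_apply (a : Fin d →₀ ℕ) (z : UnitBall d) : mono a z = ∏ i, z.1 i ^ a i := by
  rw [mono, smul_apply, FreeModule.one_apply, mul_one, MvPolynomial.eval_monomial, one_mul,
    Finsupp.prod_fintype _ _ fun i => pow_zero _]

theorem mono_zero : mono 0 = FreeModule.one d := by
  rw [mono]
  exact one_smul _ _

theorem X_smul_mono (i : Fin d) (a : Fin d →₀ ℕ) :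
    (MvPolynomial.X i : PolyRing d) • mono a = mono (a + Finsupp.single i 1) := by
  rw [mono, smul_smul, MvPolynomial.X, MvPolynomial.monomial_mul, mul_one, mono, add_comm]

theorem mono_ne_zero (a : Fin d →₀ ℕ) : mono a ≠ 0 := by
  intro h
  -- A small multiple of `(1, …, 1)` lies in the ball and has no zero coordinate, so no monomial
  -- vanishes there.
  obtain ⟨r, hr0, hr⟩ : ∃ r : ℝ, 0 < r ∧ r * ‖(WithLp.toLp 2 fun _ => 1 :
      EuclideanSpace ℂ (Fin d))‖ < 1 := by
    refine ⟨(‖(WithLp.toLp 2 fun _ => 1 : EuclideanSpace ℂ (Fin d))‖ + 1)⁻¹, by positivity, ?_⟩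
    rw [inv_mul_lt_iff₀ (by positivity)]
    linarith
  let z : UnitBall d := ⟨(r : ℂ) • WithLp.toLp 2 fun _ => 1, by
    rw [mem_ball_zero_iff, norm_smul]
    simpa [abs_of_pos hr0] using hr⟩
  have h1 := mono_apply a z
  rw [h, RKHS.coe_zero, Pi.zero_apply] at h1
  refine Finset.prod_ne_zero_iff.mpr (fun i _ => ?_) h1.symm
  simp [z, hr0.ne']

end DruryArveson

/-! ### Orthogonality and norms of monomials, and the bounded homotopy on `H_d²`. -/

namespace DruryArveson

variable {d : ℕ}

/-- The rotation of the unit ball by unimodular scalars. -/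
def rot (t : Fin d → ℂ) (ht : ∀ i, ‖t i‖ = 1) (w : UnitBall d) : UnitBall d :=
  ⟨WithLp.toLp 2 fun i => t i * w.1 i, by
    have h := mem_ball_zero_iff.mp w.2
    rw [mem_ball_zero_iff]
    rw [EuclideanSpace.norm_eq] at h ⊢
    simpa [ht] using h⟩

theorem daKer_rot (t : Fin d → ℂ) (ht : ∀ i, ‖t i‖ = 1) (z w : UnitBall d) :
    daKer d (rot t ht z) w = daKer d z (rot (star t) (by simpa using ht) w) := by
  simp only [daKer, PiLp.inner_apply, rot]
  congr 2
  refine Finset.sum_congr rfl fun i _ => ?_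
  simp
  ring

theorem rot_star_rot (t : Fin d → ℂ) (ht : ∀ i, ‖t i‖ = 1) (w : UnitBall d) :
    rot (star t) (by simpa using ht) (rot t ht w) = w := by
  refine Subtype.ext (PiLp.ext fun i => ?_)
  change star (t i) * (t i * w.1 i) = w.1 i
  rw [← mul_assoc, Complex.star_def, Complex.conj_mul', ht]
  simp

/-- Rotations of the ball act on `H_d²`. -/
theorem exists_rot (t : Fin d → ℂ) (ht : ∀ i, ‖t i‖ = 1) :
    ∃ U : DruryArveson d →L[ℂ] DruryArveson d, (∀ w, U (k w) = k (rot t ht w)) ∧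
      ∀ f z, U.adjoint f z = f (rot t ht z) := by
  let pre : (UnitBall d →₀ ℂ) →ₗ[ℂ] DruryArveson d :=
    Finsupp.linearCombination ℂ fun w => k (rot t ht w)
  have hn : ∀ g : UnitBall d → UnitBall d, (∀ z w, daKer d (g z) (g w) = daKer d z w) →
      ∀ c : UnitBall d →₀ ℂ, ((‖∑ w ∈ c.support, c w • k (g w)‖ ^ 2 : ℝ) : ℂ) =
        ∑ w ∈ c.support, ∑ z ∈ c.support, star (c w) * c z * daKer d w z := by
    intro g hg c
    have := inner_self_eq_norm_sq_to_K (𝕜 := ℂ) (∑ w ∈ c.support, c w • k (g w))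
    push_cast
    rw [← Complex.coe_algebraMap, ← this, sum_inner]
    refine Finset.sum_congr rfl fun w _ => ?_
    rw [inner_sum]
    refine Finset.sum_congr rfl fun z _ => ?_
    rw [inner_smul_left, inner_smul_right, inner_k, k_apply, hg]
    simp
    ring
  -- The kernel is invariant under rotating both arguments, so `k_w ↦ k_(tw)` preserves norms on the
  -- span.
  have hpre : ∀ c, ‖pre c‖ ≤ 1 * ‖Finsupp.linearCombination ℂ (k : _ → DruryArveson d) c‖ := by
    intro c
    rw [one_mul]
    refine le_of_eq ((sq_eq_sq₀ (norm_nonneg _) (norm_nonneg _)).mp (Complex.ofReal_injective ?_))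
    have h1 := hn (rot t ht) (fun z w => by rw [daKer_rot, rot_star_rot]) c
    have h2 := hn id (fun z w => rfl) c
    rw [← h2] at h1
    simpa [pre, Finsupp.linearCombination_apply, Finsupp.sum] using h1
  have hU : ∀ w, pre.extendOfNorm (Finsupp.linearCombination ℂ k) (k w) = k (rot t ht w) := by
    intro w
    have h := LinearMap.extendOfNorm_eq (denseRange_k (d := d)) ⟨1, hpre⟩ (Finsupp.single w 1)
    simpa [pre] using h
  refine ⟨pre.extendOfNorm (Finsupp.linearCombination ℂ k), hU, fun f z => ?_⟩
  rw [← inner_k, ContinuousLinearMap.adjoint_inner_right, hU, inner_k]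

/-- Monomials are joint eigenvectors of the rotations. Rotating one coordinate in which the
exponents differ separates the eigenvalues. -/
theorem inner_mono_of_ne {a b : Fin d →₀ ℕ} (hab : a ≠ b) :
    inner ℂ (mono a) (mono b) = 0 := by
  obtain ⟨i, hi⟩ := DFunLike.ne_iff.mp hab
  -- `N` exceeds both exponents, so a primitive `N`-th root of unity has distinct powers at `a i`
  -- and `b i`.
  set N := a i + b i + 1
  have hζ := Complex.isPrimitiveRoot_exp N (Nat.succ_ne_zero _)
  set ζ := Complex.exp (2 * Real.pi * Complex.I / N)
  have hζ1 : ‖ζ‖ = 1 := hζ.norm'_eq_one (Nat.succ_ne_zero _)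
  let t : Fin d → ℂ := Function.update 1 i ζ
  have ht : ∀ j, ‖t j‖ = 1 := fun j => by
    by_cases h : j = i
    · subst h; simpa [t] using hζ1
    · simp [t, h]
  have ht' : ∀ j, ‖star t j‖ = 1 := by simpa using ht
  obtain ⟨U, hU, hU'⟩ := exists_rot t ht
  obtain ⟨V, hV, hV'⟩ := exists_rot (star t) ht'
  -- Only adjoints are known as composition operators. Writing `U` as the adjoint for the inverse
  -- rotation gives its action on monomials.
  have hUV : U = V.adjoint := clm_ext fun w => RKHS.ext fun z => by
    rw [hU, hV', k_apply, k_apply, daKer_rot]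
    congr 2
    simp
  have hm : ∀ c : Fin d →₀ ℕ, U.adjoint (mono c) = ζ ^ c i • mono c := fun c =>
    RKHS.ext fun z => by
      have h : ∏ j, t j ^ c j = ζ ^ c i := by
        rw [Finset.prod_eq_single i]
        · simp [t]
        · intro j _ hj
          simp [t, hj]
        · simp
      rw [hU', RKHS.coe_smul, Pi.smul_apply, mono_apply, mono_apply, ← h, smul_eq_mul,
        ← Finset.prod_mul_distrib]
      exact Finset.prod_congr rfl fun j _ => mul_pow _ _ _
  have hm' : ∀ c : Fin d →₀ ℕ, U (mono c) = star ζ ^ c i • mono c := fun c =>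
    RKHS.ext fun z => by
      have h : ∏ j, star t j ^ c j = star ζ ^ c i := by
        rw [Finset.prod_eq_single i]
        · simp [t]
        · intro j _ hj
          simp [t, hj]
        · simp
      rw [hUV, hV', RKHS.coe_smul, Pi.smul_apply, mono_apply, mono_apply, ← h, smul_eq_mul,
        ← Finset.prod_mul_distrib]
      exact Finset.prod_congr rfl fun j _ => mul_pow _ _ _
  have h1 := ContinuousLinearMap.adjoint_inner_right U (mono a) (mono b)
  rw [hm, hm', inner_smul_right, inner_smul_left, map_pow, starRingEnd_apply, star_star] at h1
  by_contra h0
  have h2 := mul_right_cancel₀ h0 h1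
  exact hi (hζ.pow_inj (by lia) (by lia) h2).symm

theorem backShift_mono_of_eq_zero (i : Fin d) (a : Fin d →₀ ℕ) (ha : a i = 0) :
    backShift i (mono a) = 0 := by
  refine eq_zero_of_inner_mono _ fun b => ?_
  rw [← inner_conj_symm, ← inner_smul_X, X_smul_mono, inner_mono_of_ne, map_zero]
  rintro rfl
  simp at ha

/-- Pairing with all monomials determines the vector; by orthogonality only the pairing with `z^a`
is nonzero. -/
theorem backShift_mono_add (i : Fin d) (a : Fin d →₀ ℕ) :
    backShift i (mono (a + Finsupp.single i 1)) =
      ((‖mono (a + Finsupp.single i 1)‖ ^ 2 / ‖mono a‖ ^ 2 : ℝ) : ℂ) • mono a := by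
  rw [← sub_eq_zero]
  refine eq_zero_of_inner_mono _ fun b => ?_
  rw [inner_sub_right, ← inner_conj_symm, ← inner_smul_X, X_smul_mono, inner_smul_right]
  by_cases hb : b = a
  · subst hb
    have h := mono_ne_zero b
    rw [inner_self_eq_norm_sq_to_K, inner_self_eq_norm_sq_to_K]
    have h2 : (‖mono b‖ : ℂ) ≠ 0 := by simpa using h
    simp
    field_simp
    simp
  · rw [inner_mono_of_ne hb, inner_mono_of_ne fun h => hb (add_right_cancel h).symm]
    simp

theorem exists_eq_add_single {a : Fin d →₀ ℕ} {i : Fin d} (h : a i ≠ 0) :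
    ∃ b, a = b + Finsupp.single i 1 :=
  ⟨a - Finsupp.single i 1, (tsub_add_cancel_of_le
    (Finsupp.single_le_iff.mpr (Nat.one_le_iff_ne_zero.mpr h))).symm⟩

theorem prod_factorial_add_single (a : Fin d →₀ ℕ) (i : Fin d) :
    ∏ j, (((a + Finsupp.single i 1 : Fin d →₀ ℕ) j).factorial : ℝ) =
      (a i + 1) * ∏ j, ((a j).factorial : ℝ) := by
  rw [← Finset.mul_prod_erase _ _ (Finset.mem_univ i),
    ← Finset.mul_prod_erase (a := i) (f := fun j => ((a j).factorial : ℝ)) _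
      (Finset.mem_univ i), ← mul_assoc]
  congr 1
  · simp [Nat.factorial_succ]
  · refine Finset.prod_congr rfl fun j hj => ?_
    simp [Finsupp.single_eq_of_ne (Finset.ne_of_mem_erase hj)]

/-- For `a ≠ 0`, `sum_mul_backShift` applied to `z^a` says that the ratios `‖z^a‖² / ‖z^(a -
e_i)‖²`, over the `i` with `a_i ≠ 0`, sum to `1`. This recursion in `|a|` determines the norms. -/
theorem norm_mono_sq (a : Fin d →₀ ℕ) :
    ‖mono a‖ ^ 2 * (a.degree.factorial : ℝ) = ∏ i, ((a i).factorial : ℝ) := by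
  induction h : a.degree generalizing a with
  | zero =>
    rw [Finsupp.degree_eq_zero_iff] at h
    subst h
    have h1 := inner_self_eq_norm_sq_to_K (𝕜 := ℂ) (FreeModule.one d)
    conv_lhs at h1 => rw [FreeModule.one]
    rw [inner_k, ← FreeModule.one, FreeModule.one_apply] at h1
    have h2 : ‖FreeModule.one d‖ ^ 2 = 1 := Complex.ofReal_injective (by simpa using h1.symm)
    simp [mono_zero, h2]
  | succ n ih =>
    have h1 := sum_mul_backShift (mono a)
    have h2 : mono a (UnitBall.zero d) = 0 := by
      obtain ⟨i, hi⟩ : ∃ i, a i ≠ 0 := by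
        by_contra! h0
        have : a = 0 := Finsupp.ext h0
        simp [this] at h
      rw [mono_apply]
      exact Finset.prod_eq_zero (Finset.mem_univ i) (by simp [UnitBall.zero, hi])
    set Q := ∏ i, ((a i).factorial : ℝ) with hQ
    have hQ0 : Q ≠ 0 := Finset.prod_ne_zero_iff.mpr fun i _ => by positivity
    -- The induction hypothesis turns each ratio into a multiple of `a_i`, a form that also covers
    -- `a_i = 0`.
    have h3 : ∀ i, (MvPolynomial.X i : PolyRing d) • backShift i (mono a) =
        ((‖mono a‖ ^ 2 * n.factorial * a i / Q : ℝ) : ℂ) • mono a := by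
      intro i
      by_cases hi : a i = 0
      · rw [backShift_mono_of_eq_zero i a hi, hi]
        simp
      · obtain ⟨b, rfl⟩ := exists_eq_add_single hi
        have hb : b.degree = n := by simpa using h
        have h4 := ih b hb
        have h5 : Q = (b i + 1) * ∏ j, ((b j).factorial : ℝ) := prod_factorial_add_single b i
        rw [backShift_mono_add, smul_comm, X_smul_mono, h5, ← h4]
        congr 2
        have h6 : ‖mono b‖ ≠ 0 := norm_ne_zero_iff.mpr (mono_ne_zero b)
        have h7 : (b i + 1 : ℝ) ≠ 0 := by positivity
        have h8 : (n.factorial : ℝ) ≠ 0 := by positivity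
        simp
        field_simp
    rw [Finset.sum_congr rfl fun i _ => h3 i, ← Finset.sum_smul, h2, zero_smul, sub_zero] at h1
    have h4 : ((∑ i, (‖mono a‖ ^ 2 * n.factorial * a i / Q) : ℝ) : ℂ) = ((1 : ℝ) : ℂ) := by
      have h5 : ((∑ i, ((‖mono a‖ ^ 2 * n.factorial * a i / Q : ℝ) : ℂ)) - 1) • mono a = 0 := by
        rw [sub_smul, h1, one_smul, sub_self]
      have h6 := sub_eq_zero.mp ((smul_eq_zero.mp h5).resolve_right (mono_ne_zero a))
      rw [Complex.ofReal_sum, h6]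
      simp
    have h5 := Complex.ofReal_injective h4
    rw [← Finset.sum_div, ← Finset.mul_sum, div_eq_one_iff_eq hQ0, ← Nat.cast_sum,
      ← Finsupp.degree_eq_sum, h] at h5
    rw [Nat.factorial_succ, ← h5]
    push_cast
    ring

theorem backShift_mono (i : Fin d) (a : Fin d →₀ ℕ) :
    backShift i (mono (a + Finsupp.single i 1)) =
      ((a i + 1 : ℂ) / (a.degree + 1 : ℂ)) • mono a := by
  rw [backShift_mono_add]
  congr 1
  have h1 := norm_mono_sq a
  have h2 := norm_mono_sq (a + Finsupp.single i 1)
  rw [prod_factorial_add_single, ← h1] at h2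
  have h6 : ‖mono a‖ ≠ 0 := norm_ne_zero_iff.mpr (mono_ne_zero a)
  have h7 : ((a.degree.factorial : ℕ) : ℝ) ≠ 0 := by positivity
  have h8 : (a.degree + 1 : ℝ) ≠ 0 := by positivity
  have h9 : ‖mono (a + Finsupp.single i 1)‖ ^ 2 / ‖mono a‖ ^ 2 =
      (a i + 1 : ℝ) / (a.degree + 1 : ℝ) := by
    rw [div_eq_div_iff (by positivity) h8]
    apply mul_right_cancel₀ h7
    have h10 : (a + Finsupp.single i 1).degree = a.degree + 1 := by simp
    rw [h10, Nat.factorial_succ] at h2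
    push_cast at h2
    linear_combination h2
  rw [h9]
  push_cast
  rfl

/-- The operators of a contracting homotopy of the Koszul complex of `H_d²`: on monomials `z^a`,
`S k` is division by `|a| + k` and `R k i` is `∂/∂z_i` followed by division by `|a| + k`. -/
theorem exists_homotopy (d : ℕ) :
    ∃ (R : ℕ → Fin d → DruryArveson d →L[ℂ] DruryArveson d)
      (S : ℕ → DruryArveson d →L[ℂ] DruryArveson d),
      (∀ k, ∑ i, mulOp (MvPolynomial.X i) ∘L R (k + 1) i + ((k + 1 : ℕ) : ℂ) • S (k + 1) =
        ContinuousLinearMap.id ℂ _) ∧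
      ∀ k i j, R k j ∘L mulOp (MvPolynomial.X i) = mulOp (MvPolynomial.X i) ∘L R (k + 1) j +
        if i = j then S (k + 1) else 0 := by
  -- For `k = 0` and `a = 0` the scalar is `0⁻¹ = 0`; this is harmless, as only `S (k + 1)` occurs
  -- below.
  have hS : ∀ k : ℕ, ∃ T : DruryArveson d →L[ℂ] DruryArveson d,
      ∀ a : Fin d →₀ ℕ, T (mono a) = ((a.degree + k : ℕ) : ℂ)⁻¹ • mono a := fun k => by
    refine exists_diagonal mono (fun a b => inner_mono_of_ne) denseRange_mono _ fun a => ?_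
    rw [norm_inv, Complex.norm_natCast]
    exact Nat.cast_inv_le_one _
  choose S hS using hS
  -- On `z^b` with `b_i ≠ 0` the backward shift gives `(b_i/|b|) z^(b - e_i)`, and `1 - k/(|b| + k)
  -- = |b|/(|b| + k)`. The result is `(b_i/(|b| + k)) z^(b - e_i)`, obtained from bounded operators
  -- only.
  let R (k : ℕ) (i : Fin d) : DruryArveson d →L[ℂ] DruryArveson d :=
    backShift i - (k : ℂ) • (S (k + 1) ∘L backShift i)
  have hR0 : ∀ k i (a : Fin d →₀ ℕ), a i = 0 → R k i (mono a) = 0 := fun k i a ha => by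
    simp [R, backShift_mono_of_eq_zero i a ha]
  have hR1 : ∀ k i (a : Fin d →₀ ℕ), R k i (mono (a + Finsupp.single i 1)) =
      ((a i + 1 : ℂ) / (a.degree + 1 + k : ℂ)) • mono a := fun k i a => by
    have h1 : (a.degree + 1 : ℂ) ≠ 0 := by exact_mod_cast Nat.succ_ne_zero a.degree
    have h2 : (a.degree + 1 + k : ℂ) ≠ 0 := by
      have : ((a.degree + 1 + k : ℕ) : ℂ) ≠ 0 := by
        rw [Nat.cast_ne_zero]; lia
      push_cast at this
      exact this
    have h3 : (a.degree + (k + 1) : ℂ) ≠ 0 := by rwa [add_comm (k : ℂ), ← add_assoc]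
    simp only [R, sub_apply, FunLike.coe_smul, Pi.smul_apply,
      ContinuousLinearMap.comp_apply,
      backShift_mono, map_smul, hS, smul_smul, ← sub_smul]
    congr 1
    push_cast
    field_simp
    ring
  refine ⟨R, S, fun k => clm_ext_mono fun a => ?_,
    fun k i j => clm_ext_mono fun a => ?_⟩
  · have h1 : ∀ i, mulOp (MvPolynomial.X i) (R (k + 1) i (mono a)) =
        ((a i : ℂ) / (a.degree + (k + 1) : ℂ)) • mono a := fun i => by
      by_cases hi : a i = 0
      · rw [hR0 _ _ _ hi, hi]
        simp
      · obtain ⟨b, rfl⟩ := exists_eq_add_single hi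
        rw [hR1, map_smul, ← smul_eq_mulOp, X_smul_mono]
        simp
    have h2 : (a.degree + (k + 1) : ℂ) ≠ 0 := by
      exact_mod_cast Nat.succ_ne_zero (a.degree + k)
    simp only [add_apply, sum_apply, ContinuousLinearMap.comp_apply, h1, hS,
      FunLike.coe_smul, Pi.smul_apply,
      ContinuousLinearMap.id_apply, ← Finset.sum_smul, smul_smul, ← add_smul]
    rw [← Finset.sum_div, ← Nat.cast_sum, ← Finsupp.degree_eq_sum]
    push_cast
    rw [← div_eq_mul_inv, ← add_div, div_self h2, one_smul]
  · have h2 : (a.degree + (k + 1) : ℂ) ≠ 0 := by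
      exact_mod_cast Nat.succ_ne_zero (a.degree + k)
    simp only [add_apply, ContinuousLinearMap.comp_apply, ← smul_eq_mulOp, X_smul_mono]
    by_cases hij : i = j
    · subst hij
      rw [hR1, if_pos rfl, hS]
      by_cases hi : a i = 0
      · rw [hR0 _ _ _ hi, hi, smul_zero, zero_add]
        congr 1
        push_cast
        rw [zero_add, one_div, add_assoc, add_comm (1 : ℂ)]
      · obtain ⟨b, rfl⟩ := exists_eq_add_single hi
        rw [hR1, smul_comm, X_smul_mono, ← add_smul]
        congr 1
        have h3 : (b.degree + 1 + 1 + k : ℂ) = b.degree + 1 + (k + 1) := by ring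
        simp only [map_add, Finsupp.degree_single, Finsupp.add_apply, Finsupp.single_eq_same]
        push_cast
        rw [h3, ← one_div, ← add_div]
    · rw [if_neg hij, zero_apply, add_zero]
      by_cases hj : a j = 0
      · rw [hR0 _ _ _ hj, hR0 _ _ _ (by simp [hj, Finsupp.single_eq_of_ne (Ne.symm hij)]),
          smul_zero]
      · obtain ⟨b, rfl⟩ := exists_eq_add_single hj
        rw [add_right_comm, hR1, hR1, smul_comm, X_smul_mono]
        congr 1
        simp [Finsupp.single_eq_of_ne (Ne.symm hij)]
        ring

end DruryArveson

/-! ### Koszul homology of the free modules `H_d² ⊗ C`. -/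

namespace FreeModule

variable {d : ℕ} {C D : Type*} [NormedAddCommGroup C] [InnerProductSpace ℂ C]
  [NormedAddCommGroup D] [InnerProductSpace ℂ D]

/-- The map `f ↦ f ⊗ η`. -/
def tmulR (η : C) : DruryArveson d →ₗ[ℂ] FreeModule d C :=
  UniformSpace.Completion.toComplL.toLinearMap ∘ₗ (TensorProduct.mk ℂ (DruryArveson d) C).flip η

theorem tmulL_eq_tmulR (f : DruryArveson d) (η : C) : tmulL f η = tmulR η f := rfl

theorem clm_ext {E : Type*} [NormedAddCommGroup E] [NormedSpace ℂ E]
    {S T : FreeModule d C →L[ℂ] E} (h : ∀ f η, S (tmulR η f) = T (tmulR η f)) : S = T := by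
  refine ContinuousLinearMap.ext fun ξ => ?_
  induction ξ using UniformSpace.Completion.induction_on with
  | hp => exact isClosed_eq S.continuous T.continuous
  | ih x =>
    induction x using TensorProduct.induction_on with
    | zero => rw [UniformSpace.Completion.coe_zero, map_zero, map_zero]
    | tmul f η => exact h f η
    | add x y hx hy => rw [UniformSpace.Completion.coe_add, map_add, map_add, hx, hy]

/-- The operator `T ⊗ 1` on `H_d² ⊗ C`. -/
def amp (C : Type*) [NormedAddCommGroup C] [InnerProductSpace ℂ C]
    (T : DruryArveson d →L[ℂ] DruryArveson d) : FreeModule d C →L[ℂ] FreeModule d C :=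
  (T.rTensor C).completion

theorem amp_coe (T : DruryArveson d →L[ℂ] DruryArveson d) (x : DruryArveson d ⊗[ℂ] C) :
    amp C T (x : FreeModule d C) = (T.rTensor C x : DruryArveson d ⊗[ℂ] C) :=
  UniformSpace.Completion.map_coe (T.rTensor C).uniformContinuous x

theorem amp_tmulR (T : DruryArveson d →L[ℂ] DruryArveson d) (η : C) (f : DruryArveson d) :
    amp C T (tmulR η f) = tmulR η (T f) :=
  amp_coe T (f ⊗ₜ η)

theorem amp_mulOp (p : PolyRing d) (ξ : FreeModule d C) :
    amp C (DruryArveson.mulOp p) ξ = p • ξ := by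
  induction ξ using UniformSpace.Completion.induction_on with
  | hp => exact isClosed_eq (amp C _).continuous (continuous_const_smul p)
  | ih x => rw [amp_coe, ← DruryArveson.smul_tensor, UniformSpace.Completion.coe_smul]

/-- Being bounded, the homotopy operators on `H_d²` extend to the completed tensor product as `T ⊗
1`; their relations need checking only on elementary tensors. -/
theorem koszulD_exact (k : ℕ) :
    Function.Exact (koszulD (d := d) (FreeModule d C) (k + 1))
      (koszulD (d := d) (FreeModule d C) k) := by
  obtain ⟨R, S, h1, h2⟩ := DruryArveson.exists_homotopy d
  refine koszulD_exact_of_homotopy (fun k i => (amp C (R k i)).toLinearMap)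
    (fun k => (amp C (S k)).toLinearMap) (fun k ξ => ?_) (fun k i j ξ => ?_) k
  · have h : ∑ i, amp C (DruryArveson.mulOp (MvPolynomial.X i : PolyRing d)) ∘L
        amp C (R (k + 1) i) + ((k + 1 : ℕ) : ℂ) • amp C (S (k + 1)) =
        ContinuousLinearMap.id ℂ _ := by
      refine clm_ext fun f η => ?_
      have h3 := DFunLike.congr_fun (h1 k) f
      simp only [add_apply, sum_apply, FunLike.coe_smul, Pi.smul_apply,
        ContinuousLinearMap.comp_apply, amp_tmulR, ContinuousLinearMap.id_apply] at h3 ⊢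
      rw [← map_sum, ← map_smul, ← map_add, h3]
    have h3 := DFunLike.congr_fun h ξ
    simp only [add_apply, sum_apply, FunLike.coe_smul, Pi.smul_apply,
      ContinuousLinearMap.comp_apply, amp_mulOp, ContinuousLinearMap.id_apply] at h3
    exact h3
  · have h : amp C (R k j) ∘L amp C (DruryArveson.mulOp (MvPolynomial.X i : PolyRing d)) =
        amp C (DruryArveson.mulOp (MvPolynomial.X i : PolyRing d)) ∘L amp C (R (k + 1) j) +
          if i = j then amp C (S (k + 1)) else 0 := by
      refine clm_ext fun f η => ?_
      have h3 := DFunLike.congr_fun (h2 k i j) f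
      split_ifs at h3 ⊢ <;>
      · simp only [add_apply, ContinuousLinearMap.comp_apply, amp_tmulR, zero_apply] at h3 ⊢
        rw [h3]
        simp
    have h3 := DFunLike.congr_fun h ξ
    split_ifs at h3 ⊢ <;>
    · simp only [add_apply, ContinuousLinearMap.comp_apply, amp_mulOp, zero_apply] at h3
      exact h3

variable [CompleteSpace C]

theorem eval_tmulR (z : UnitBall d) (f : DruryArveson d) (η : C) :
    eval z (tmulR η f) = f z • η := by
  rw [← tmulL_eq_tmulR, eval_tmulL]

theorem eval_smul (z : UnitBall d) (p : PolyRing d) (ξ : FreeModule d C) :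
    eval z (p • ξ) = MvPolynomial.eval (fun i => z.1 i) p • eval z ξ := by
  have h : eval z ∘L amp C (DruryArveson.mulOp p) =
      MvPolynomial.eval (fun i => z.1 i) p • eval z := by
    refine clm_ext fun f η => ?_
    rw [ContinuousLinearMap.comp_apply, amp_tmulR, eval_tmulR, DruryArveson.mulOp_apply, mul_smul,
      ← eval_tmulR]
    rfl
  rw [← amp_mulOp]
  exact DFunLike.congr_fun h ξ

theorem eval_zero_X_smul (i : Fin d) (ξ : FreeModule d C) :
    eval (UnitBall.zero d) ((MvPolynomial.X i : PolyRing d) • ξ) = 0 := by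
  rw [eval_smul]
  simp [UnitBall.zero]

/-- The amplification of `sum_mul_backShift`: an element vanishing at `0` is explicitly a
combination of the coordinates. -/
theorem sum_X_smul_amp_backShift (ξ : FreeModule d C) :
    ∑ i, (MvPolynomial.X i : PolyRing d) • amp C (DruryArveson.backShift i) ξ =
      ξ - tmulL (one d) (eval (UnitBall.zero d) ξ) := by
  have h : ∑ i, amp C (DruryArveson.mulOp (MvPolynomial.X i : PolyRing d)) ∘L
      amp C (DruryArveson.backShift i) =
      ContinuousLinearMap.id ℂ _ - tmulL (one d) ∘L eval (UnitBall.zero d) := by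
    refine clm_ext fun f η => ?_
    have h1 := DruryArveson.sum_mul_backShift f
    simp only [sum_apply, sub_apply, ContinuousLinearMap.comp_apply, amp_tmulR,
      ContinuousLinearMap.id_apply, eval_tmulR, map_smul, tmulL_eq_tmulR]
    rw [← map_sum, ← map_smul, ← map_sub, ← h1]
    rfl
  have h1 := DFunLike.congr_fun h ξ
  simpa only [sum_apply, sub_apply, ContinuousLinearMap.comp_apply, amp_mulOp,
      ContinuousLinearMap.id_apply] using h1

theorem eval_one_tmul (η : C) : eval (UnitBall.zero d) (tmulL (one d) η) = η := by
  rw [eval_tmulL, one_apply, one_smul]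

/-- The augmentation of the Koszul complex of `H_d² ⊗ C` given by evaluation at `0`. -/
def koszulAug (d : ℕ) (C : Type*) [NormedAddCommGroup C] [InnerProductSpace ℂ C]
    [CompleteSpace C] : FreeModule d C ⊗[ℂ] ⋀[ℂ]^0 (Fin d → ℂ) →ₗ[ℂ] C :=
  (eval (UnitBall.zero d)).toLinearMap ∘ₗ (TensorProduct.rid ℂ (FreeModule d C)).toLinearMap ∘ₗ
    LinearMap.lTensor _ (exteriorPower.zeroEquiv ℂ (Fin d → ℂ)).toLinearMap

theorem koszulAug_tmul (ξ : FreeModule d C) (x : ⋀[ℂ]^0 (Fin d → ℂ)) :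
    koszulAug d C (ξ ⊗ₜ x) = exteriorPower.zeroEquiv ℂ _ x • eval (UnitBall.zero d) ξ := by
  simp [koszulAug]

theorem koszulAug_surjective : Function.Surjective (koszulAug d C) := fun η =>
  ⟨tmulL (one d) η ⊗ₜ (exteriorPower.zeroEquiv ℂ _).symm 1, by
    rw [koszulAug_tmul, LinearEquiv.apply_symm_apply, one_smul, eval_one_tmul]⟩

theorem koszulAug_exact : Function.Exact (koszulD (d := d) (FreeModule d C) 0) (koszulAug d C) := by
  intro w
  constructor
  · intro hw
    obtain ⟨ξ, rfl⟩ : ∃ ξ : FreeModule d C, w = ξ ⊗ₜ (exteriorPower.zeroEquiv ℂ _).symm 1 := by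
      clear hw
      induction w using TensorProduct.induction_on with
      | zero => exact ⟨0, by simp⟩
      | tmul ξ x =>
        refine ⟨exteriorPower.zeroEquiv ℂ _ x • ξ, ?_⟩
        rw [TensorProduct.smul_tmul, ← map_smul, smul_eq_mul, mul_one,
          LinearEquiv.symm_apply_apply]
      | add x y hx hy =>
        obtain ⟨ξ, rfl⟩ := hx
        obtain ⟨ξ', rfl⟩ := hy
        exact ⟨ξ + ξ', (TensorProduct.add_tmul _ _ _).symm⟩
    rw [koszulAug_tmul, LinearEquiv.apply_symm_apply, one_smul] at hw
    have h := sum_X_smul_amp_backShift ξ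
    rw [hw, map_zero, sub_zero] at h
    set x : ⋀[ℂ]^0 (Fin d → ℂ) := (exteriorPower.zeroEquiv ℂ _).symm 1
    -- The boundary of this element is `∑ z_j (M_j^* ⊗ 1) ξ`, which equals `ξ` because `ξ(0) = 0`.
    refine ⟨∑ j, amp C (DruryArveson.backShift j) ξ ⊗ₜ wedge j 0 x, ?_⟩
    simp only [map_sum, koszulD_tmul', contract_wedge_zero]
    conv_rhs => rw [← h, TensorProduct.sum_tmul]
    refine Finset.sum_congr rfl fun j _ => ?_
    rw [Finset.sum_eq_single j]
    · simp
    · intro i _ hi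
      simp [hi]
    · simp
  · rintro ⟨u, rfl⟩
    induction u using TensorProduct.induction_on with
    | zero => simp
    | tmul ξ x => simp [koszulD_tmul', koszulAug_tmul, eval_zero_X_smul]
    | add x y hx hy => rw [map_add, map_add, hx, hy, add_zero]

variable [CompleteSpace D]

/-- The difference `ξ - 1 ⊗ ξ(0)` lies in `∑ z_i (H_d² ⊗ D)`. A module map sends it into `∑ z_i
(H_d² ⊗ C)`, which vanishes at `0`. -/
theorem eval_zero_apply (Φ : FreeModule d D →L[PolyRing d] FreeModule d C) (ξ : FreeModule d D) :
    eval (UnitBall.zero d) (Φ ξ) =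
      localize Φ (UnitBall.zero d) (eval (UnitBall.zero d) ξ) := by
  have h := congrArg Φ (sum_X_smul_amp_backShift ξ)
  rw [map_sub, map_sum] at h
  have h1 := congrArg (eval (UnitBall.zero d)) h
  simp only [map_sum, map_smul, eval_zero_X_smul, Finset.sum_const_zero, map_sub] at h1
  exact sub_eq_zero.mp h1.symm

theorem koszulAug_koszulMap (Φ : FreeModule d D →L[PolyRing d] FreeModule d C)
    (w : FreeModule d D ⊗[ℂ] ⋀[ℂ]^0 (Fin d → ℂ)) :
    koszulAug d C (koszulMap Φ.toLinearMap 0 w) =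
      localize Φ (UnitBall.zero d) (koszulAug d D w) := by
  induction w using TensorProduct.induction_on with
  | zero => simp
  | tmul ξ x =>
    rw [koszulAug_tmul, map_smul, ← eval_zero_apply, ← koszulAug_tmul]
    rfl
  | add x y hx hy => simp only [map_add, hx, hy]

end FreeModule

/-- Here `koszulD H k` is the Koszul map `∂_{k+1}` of `H`, and `R.Φ k` is the map `Φ_{k+1}` of the
resolution; so `k : ℕ` below runs through all degrees `k + 1 ≥ 1`. -/
theorem theorem39p25 (d : ℕ) (H : Type*) [NormedAddCommGroup H] [InnerProductSpace ℂ H]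
    [CompleteSpace H] [Module (PolyRing d) H] [ContractiveModule d H] (hH : IsPure d H)
    (C : ℕ → Type*) [∀ n, NormedAddCommGroup (C n)] [∀ n, InnerProductSpace ℂ (C n)]
    [∀ n, CompleteSpace (C n)] (R : FreeResolution d H C) (k : ℕ) :
    Nonempty
      (HomologyAt (koszulD (d := d) H (k + 1)) (koszulD (d := d) H k) ≃ₗ[ℂ]
        HomologyAt
          (FreeModule.localize (R.Φ (k + 1)) (UnitBall.zero d)).toLinearMap
          (FreeModule.localize (R.Φ k) (UnitBall.zero d)).toLinearMap) :=
  nonempty_koszul_homology_equiv k (F := fun n => FreeModule d (C n)) (Y := C)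
    (fun n => (R.Φ n).toLinearMap) R.aug.toLinearMap R.exact R.exact_aug R.surjective_aug
    (fun _ k => FreeModule.koszulD_exact k)
    (fun n => (FreeModule.localize (R.Φ n) (UnitBall.zero d)).toLinearMap)
    (fun n => FreeModule.koszulAug d (C n)) (fun _ => FreeModule.koszulAug_surjective)
    (fun _ => FreeModule.koszulAug_exact) fun n => FreeModule.koszulAug_koszulMap (R.Φ n)

end
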